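/- Let $F$ be Thompson's group: the group, under composition, of the increasing piecewise-linear homeomorphisms of $[0,1]$ with finitely many breakpoints, all of whose slopes are integral powers of $2$ and all of whose breakpoints have dyadic rational coordinates. A tree pair is an ordered pair $(T,S)$ of finite rooted binary trees with the same number of carets (internal nodes); this number is its size. To the root of a tree we attach the interval $[0,1]$, and to the two children of a caret the two halves of its interval. A tree pair represents the element of $F$ that, for each $i$, maps the interval of the $i$-th leaf of $T$ affinely onto the interval of the $i$-th leaf of $S$ (leaves numbered from left to right). A tree pair is reduced if its size is at least $1$ and, in case its size is at least $2$, there is no $j$ such that in both trees the leaves $j$ and $j+1$ are the two leaves of one caret; so the pair of two single carets, which represents the identity, is reduced. For $k\ge 0$ let $X_k$ be the set of unordered $k$-tuples (repetitions allowed) of reduced tree pairs, and let $\mathrm{Sph}^{\mathrm{sum}}_k(n)\subset X_k$ be the finite set of those tuples the sum of whose sizes is $n$. For a subgroup $H$ of $F$ let $T_H\subset X_k$ be the set of tuples whose entries represent elements that generate a subgroup of $F$ isomorphic to $H$. Say that $H$ is visible, and write $H\in\mathrm{Spec}^{\mathrm{sum}}_k(F)$, if $T_H$ has positive lower asymptotic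 density with respect to the sum stratification, that is, $$\liminf_{n\to\infty}\frac{|T_H\cap \mathrm{Sph}^{\mathrm{sum}}_k(n)|}{|\mathrm{Sph}^{\mathrm{sum}}_k(n)|}>0 .$$ Theorem. Let $H=\langle h_1,\dots,h_m\rangle$ be a nontrivial subgroup of $F$ generated by $m$ elements. Then $H\in\mathrm{Spec}^{\mathrm{sum}}_k(F)$ for all $k\ge m$. -/

import Mathlib

open Filter Topology Set

noncomputable section

/-! ### Thompson's group `F` as a group of piecewise-linear homeomorphisms of `[0,1]` -/

/-- Dyadic rationals. -/
def IsDyadic (x : ℝ) : Prop := ∃ (a : ℤ) (n : ℕ), x = a / 2 ^ n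

theorem IsDyadic.zero : IsDyadic 0 := ⟨0, 0, by simp⟩

theorem IsDyadic.one : IsDyadic 1 := ⟨1, 0, by simp⟩

theorem IsDyadic.add {x y : ℝ} (hx : IsDyadic x) (hy : IsDyadic y) : IsDyadic (x + y) := by
  obtain ⟨a, n, rfl⟩ := hx
  obtain ⟨b, m, rfl⟩ := hy
  refine ⟨a * 2 ^ m + b * 2 ^ n, n + m, ?_⟩
  push_cast
  field_simp
  ring

theorem IsDyadic.neg {x : ℝ} (hx : IsDyadic x) : IsDyadic (-x) := by
  obtain ⟨a, n, rfl⟩ := hx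
  exact ⟨-a, n, by push_cast; ring⟩

theorem IsDyadic.zpow_mul {x : ℝ} (hx : IsDyadic x) (n : ℤ) : IsDyadic (2 ^ n * x) := by
  obtain ⟨a, m, rfl⟩ := hx
  obtain ⟨j, rfl | rfl⟩ := n.eq_nat_or_neg
  · exact ⟨a * 2 ^ j, m, by push_cast; rw [zpow_natCast]; ring⟩
  · refine ⟨a, m + j, ?_⟩
    rw [zpow_neg, zpow_natCast, pow_add]
    field_simp

/-- An increasing bijection `f` of `[0,1]` (automatically a homeomorphism) is dyadic
piecewise linear if there is a finite set `D` of points (containing the breakpoints of `f`), whose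
coordinates `d` and `f d` are dyadic rationals, such that on every interval `[a,b]` that has no
point of `D` in its interior `f` is affine and its slope is an integral power of `2`. -/
def IsDyadicPL (f : Icc (0 : ℝ) 1 ≃o Icc (0 : ℝ) 1) : Prop :=
  ∃ D : Finset (Icc (0 : ℝ) 1),
    (∀ d ∈ D, IsDyadic (d : ℝ) ∧ IsDyadic (f d : ℝ)) ∧
    ∀ a b : Icc (0 : ℝ) 1, a < b → (∀ d ∈ D, d ≤ a ∨ b ≤ d) →
      ∃ (n : ℤ) (c : ℝ), ∀ x ∈ Icc a b, (f x : ℝ) = 2 ^ n * (x : ℝ) + c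

theorem IsDyadicPL.map_dyadic {f : Icc (0 : ℝ) 1 ≃o Icc (0 : ℝ) 1} (hf : IsDyadicPL f)
    {x : Icc (0 : ℝ) 1} (hx : IsDyadic (x : ℝ)) : IsDyadic (f x : ℝ) := by
  classical
  obtain ⟨D, hD, haff⟩ := hf
  have hbot : ((f ⊥ : Icc (0 : ℝ) 1) : ℝ) = 0 := by rw [f.map_bot]; rfl
  have hne : ((insert ⊥ D).filter (· ≤ x)).Nonempty := ⟨⊥, by simp⟩
  obtain ⟨a, ha, hmax⟩ := Finset.exists_max_image _ id hne
  simp only [Finset.mem_filter, Finset.mem_insert, id] at ha hmax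
  have hda : IsDyadic (a : ℝ) ∧ IsDyadic (f a : ℝ) := by
    rcases ha.1 with rfl | h
    · exact ⟨IsDyadic.zero, by rw [hbot]; exact IsDyadic.zero⟩
    · exact hD _ h
  rcases ha.2.eq_or_lt with rfl | hlt
  · exact hda.2
  · obtain ⟨n, c, h⟩ := haff a x hlt fun d hd => by
      rcases le_total d x with hdx | hdx
      · exact Or.inl (hmax d ⟨Or.inr hd, hdx⟩)
      · exact Or.inr hdx
    have h1 := h a ⟨le_rfl, hlt.le⟩
    have h2 := h x ⟨hlt.le, le_rfl⟩
    have : (f x : ℝ) = 2 ^ n * (x : ℝ) + ((f a : ℝ) + -(2 ^ n * (a : ℝ))) := by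
      rw [h1, h2]; ring
    rw [this]
    exact (hx.zpow_mul n).add (hda.2.add (hda.1.zpow_mul n).neg)

theorem IsDyadicPL.one : IsDyadicPL 1 :=
  ⟨∅, by simp, fun _ _ _ _ => ⟨0, 0, fun x _ => by simp⟩⟩

theorem IsDyadicPL.inv {f : Icc (0 : ℝ) 1 ≃o Icc (0 : ℝ) 1} (hf : IsDyadicPL f) :
    IsDyadicPL f⁻¹ := by
  classical
  obtain ⟨D, hD, haff⟩ := hf
  have hsymm : ∀ y, f⁻¹ y = f.symm y := fun _ => rfl
  refine ⟨D.image f, ?_, ?_⟩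
  · simp only [Finset.mem_image, forall_exists_index, and_imp, forall_apply_eq_imp_iff₂]
    intro d hd
    rw [hsymm, f.symm_apply_apply]
    exact (hD d hd).symm
  · intro a b hab h
    obtain ⟨n, c, hn⟩ := haff (f.symm a) (f.symm b) (f.symm.strictMono hab) fun d hd => by
      rw [f.le_symm_apply, f.symm_apply_le]
      exact h (f d) (Finset.mem_image_of_mem f hd)
    refine ⟨-n, -(2 ^ (-n) * c), fun x hx => ?_⟩
    have := hn (f.symm x) ⟨f.symm.monotone hx.1, f.symm.monotone hx.2⟩
    rw [f.apply_symm_apply] at this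
    rw [hsymm, this, zpow_neg]
    have h2 : (2 : ℝ) ^ n ≠ 0 := by positivity
    field_simp
    ring

theorem IsDyadicPL.mul {f g : Icc (0 : ℝ) 1 ≃o Icc (0 : ℝ) 1} (hf : IsDyadicPL f)
    (hg : IsDyadicPL g) : IsDyadicPL (f * g) := by
  classical
  have hg' := hg.inv
  have hf0 := hf
  have hg0 := hg
  obtain ⟨D, hD, hDaff⟩ := hf
  obtain ⟨E, hE, hEaff⟩ := hg
  have hmul : ∀ y, (f * g) y = f (g y) := fun _ => rfl
  refine ⟨E ∪ D.image g.symm, ?_, ?_⟩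
  · intro d hd
    have : IsDyadic (d : ℝ) := by
      rcases Finset.mem_union.1 hd with hd | hd
      · exact (hE d hd).1
      · obtain ⟨e, he, rfl⟩ := Finset.mem_image.1 hd
        exact hg'.map_dyadic (hD e he).1
    exact ⟨this, hf0.map_dyadic (hg0.map_dyadic this)⟩
  · intro a b hab h
    obtain ⟨n, c, hn⟩ := hEaff a b hab fun d hd => h d (Finset.mem_union_left _ hd)
    obtain ⟨m, c', hm⟩ := hDaff (g a) (g b) (g.strictMono hab) fun d hd => by
      have := h (g.symm d) (Finset.mem_union_right _ (Finset.mem_image_of_mem _ hd))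
      rwa [g.symm_apply_le, g.le_symm_apply] at this
    refine ⟨m + n, 2 ^ m * c + c', fun x hx => ?_⟩
    rw [hmul, hm (g x) ⟨g.monotone hx.1, g.monotone hx.2⟩, hn x hx, zpow_add₀ (by norm_num)]
    ring

/-- Thompson's group `F`: the group, under composition, of the dyadic piecewise-linear increasing
homeomorphisms of `[0,1]`. -/
def ThompsonF : Subgroup (Icc (0 : ℝ) 1 ≃o Icc (0 : ℝ) 1) where
  carrier := {f | IsDyadicPL f}
  mul_mem' := IsDyadicPL.mul
  one_mem' := IsDyadicPL.one
  inv_mem' := IsDyadicPL.inv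

/-! ### Trees and leaf intervals

A finite rooted binary tree is a `BinaryTree Unit`; its carets are its nodes and its leaves are the
occurrences of `nil`, numbered from left to right starting with `0`.  The root carries the interval
`[0,1]`, and the two children of a caret carry the two halves of the interval of the caret. -/

/-- For a tree with `N` leaves, the piecewise-linear map that sends `[0,N]` to `[0,1]`
and, for each `i < N`, sends `[i,i+1]` affinely onto the dyadic interval of leaf `i`.
(Outside `[0,N]` it continues with the slopes of the first and the last leaf.) -/
def leafMap : BinaryTree Unit → ℝ → ℝ
  | .nil, x => x
  | .node _ l r, x =>
      if x ≤ l.numLeaves then leafMap l x / 2 else (1 + leafMap r (x - l.numLeaves)) / 2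

/-- The inverse of `leafMap`. -/
def leafCoord : BinaryTree Unit → ℝ → ℝ
  | .nil, y => y
  | .node _ l r, y =>
      if y ≤ 1 / 2 then leafCoord l (2 * y) else l.numLeaves + leafCoord r (2 * y - 1)

theorem leafMap_zero (t : BinaryTree Unit) : leafMap t 0 = 0 := by
  induction t with
  | nil => rfl
  | node _ l r hl _ => simp [leafMap, hl]

theorem leafMap_numLeaves (t : BinaryTree Unit) : leafMap t t.numLeaves = 1 := by
  induction t with
  | nil => simp [leafMap]
  | node _ l r _ hr =>
    have h : (0 : ℝ) < r.numLeaves := by exact_mod_cast r.numLeaves_pos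
    have h' : ¬ ((l.numLeaves : ℝ) + r.numLeaves ≤ l.numLeaves) := by linarith
    simp only [leafMap, BinaryTree.numLeaves, Nat.cast_add, if_neg h', add_sub_cancel_left, hr]
    norm_num

theorem leafMap_strictMono (t : BinaryTree Unit) : StrictMono (leafMap t) := by
  induction t with
  | nil => exact fun _ _ h => h
  | node _ l r hl hr =>
    intro x y hxy
    simp only [leafMap]
    split_ifs with hx hy hy
    · have := hl hxy; linarith
    · have h1 := hl.monotone hx
      rw [leafMap_numLeaves] at h1
      have h2 := hr (show (0 : ℝ) < y - l.numLeaves by linarith)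
      rw [leafMap_zero] at h2
      linarith
    · linarith
    · have := hr (show x - l.numLeaves < y - l.numLeaves by linarith); linarith

theorem leafMap_leafCoord (t : BinaryTree Unit) (y : ℝ) : leafMap t (leafCoord t y) = y := by
  induction t generalizing y with
  | nil => rfl
  | node _ l r hl hr =>
    simp only [leafCoord]
    split_ifs with hy
    · have : leafCoord l (2 * y) ≤ l.numLeaves := by
        rw [← (leafMap_strictMono l).le_iff_le, hl, leafMap_numLeaves]; linarith
      simp only [leafMap, if_pos this, hl]
      ring
    · have : 0 < leafCoord r (2 * y - 1) := by
        rw [← (leafMap_strictMono r).lt_iff_lt, hr, leafMap_zero]; linarith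
      have h' : ¬ ((l.numLeaves : ℝ) + leafCoord r (2 * y - 1) ≤ l.numLeaves) := by linarith
      simp only [leafMap, if_neg h', add_sub_cancel_left, hr]
      ring

theorem leafCoord_leafMap (t : BinaryTree Unit) (x : ℝ) : leafCoord t (leafMap t x) = x :=
  (leafMap_strictMono t).injective (leafMap_leafCoord t _)

theorem leafMap_dyadic (t : BinaryTree Unit) (i : ℕ) : IsDyadic (leafMap t i) := by
  induction t generalizing i with
  | nil => exact ⟨i, 0, by simp [leafMap]⟩
  | node _ l r hl hr =>
    simp only [leafMap]
    split_ifs with h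
    · have := (hl i).zpow_mul (-1)
      rwa [zpow_neg_one, inv_mul_eq_div] at this
    · have h' : l.numLeaves ≤ i := by
        have : l.numLeaves < i := by exact_mod_cast not_le.1 h
        exact this.le
      have := (IsDyadic.one.add (hr (i - l.numLeaves))).zpow_mul (-1)
      rwa [zpow_neg_one, inv_mul_eq_div, Nat.cast_sub h'] at this

/-- `leafMap` is affine on each `[i,i+1]`, with slope a power of `2`. -/
theorem leafMap_affine (t : BinaryTree Unit) (i : ℕ) (hi : i < t.numLeaves) :
    ∃ (n : ℤ) (c : ℝ), ∀ x ∈ Icc (i : ℝ) (i + 1), leafMap t x = 2 ^ n * x + c := by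
  induction t generalizing i with
  | nil => exact ⟨0, 0, fun x _ => by simp [leafMap]⟩
  | node _ l r hl hr =>
    by_cases h : i < l.numLeaves
    · obtain ⟨n, c, hn⟩ := hl i h
      refine ⟨n - 1, c / 2, fun x hx => ?_⟩
      have h1 : ((i : ℝ) + 1) ≤ l.numLeaves := by exact_mod_cast h
      have : x ≤ l.numLeaves := hx.2.trans h1
      simp only [leafMap, if_pos this, hn x hx]
      rw [zpow_sub_one₀ (by norm_num)]
      ring
    · have h' : l.numLeaves ≤ i := not_lt.1 h
      simp only [BinaryTree.numLeaves] at hi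
      obtain ⟨n, c, hn⟩ := hr (i - l.numLeaves) (by omega)
      rw [Nat.cast_sub h'] at hn
      refine ⟨n - 1, (1 + c - 2 ^ n * l.numLeaves) / 2, fun x hx => ?_⟩
      have h1 : (l.numLeaves : ℝ) ≤ i := by exact_mod_cast h'
      have key : leafMap (.node () l r) x = (1 + leafMap r (x - l.numLeaves)) / 2 := by
        by_cases hx' : x ≤ l.numLeaves
        · have : x = l.numLeaves := le_antisymm hx' (h1.trans hx.1)
          subst this
          simp [leafMap, leafMap_numLeaves, leafMap_zero]
        · simp only [leafMap, if_neg hx']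
      rw [key, hn (x - l.numLeaves) ⟨by linarith [hx.1], by linarith [hx.2]⟩,
        zpow_sub_one₀ (by norm_num)]
      ring

theorem leafMap_leafCoord_mem {s t : BinaryTree Unit} (h : s.numLeaves = t.numLeaves) {x : ℝ}
    (hx : x ∈ Icc (0 : ℝ) 1) : leafMap t (leafCoord s x) ∈ Icc (0 : ℝ) 1 := by
  constructor
  · rw [← leafMap_zero t, (leafMap_strictMono _).le_iff_le,
      ← (leafMap_strictMono s).le_iff_le, leafMap_leafCoord, leafMap_zero]
    exact hx.1
  · rw [← leafMap_numLeaves t, (leafMap_strictMono _).le_iff_le, ← h,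
      ← (leafMap_strictMono s).le_iff_le, leafMap_leafCoord, leafMap_numLeaves]
    exact hx.2

/-! ### Tree pairs -/

/-- A tree pair diagram: an ordered pair of trees with the same number of carets. -/
structure TreePair where
  source : BinaryTree Unit
  target : BinaryTree Unit
  numNodes_eq : source.numNodes = target.numNodes

namespace TreePair

/-- The number of carets in either tree of the pair. -/
def size (p : TreePair) : ℕ := p.source.numNodes

theorem numLeaves_eq (p : TreePair) : p.source.numLeaves = p.target.numLeaves := by
  rw [BinaryTree.numLeaves_eq_numNodes_succ, BinaryTree.numLeaves_eq_numNodes_succ, p.numNodes_eq]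

/-- The homeomorphism of `[0,1]` defined by a tree pair: for each `i` it sends the
dyadic interval of leaf `i` of the first tree affinely onto the dyadic interval of leaf `i` of the
second tree. -/
def toOrderIso (p : TreePair) : Icc (0 : ℝ) 1 ≃o Icc (0 : ℝ) 1 where
  toFun x := ⟨leafMap p.target (leafCoord p.source x),
    leafMap_leafCoord_mem p.numLeaves_eq x.2⟩
  invFun x := ⟨leafMap p.source (leafCoord p.target x),
    leafMap_leafCoord_mem p.numLeaves_eq.symm x.2⟩
  left_inv x := Subtype.ext (by simp [leafCoord_leafMap, leafMap_leafCoord])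
  right_inv x := Subtype.ext (by simp [leafCoord_leafMap, leafMap_leafCoord])
  map_rel_iff' {x y} := by
    simp only [Equiv.coe_fn_mk, ← Subtype.coe_le_coe]
    rw [(leafMap_strictMono _).le_iff_le, ← (leafMap_strictMono p.source).le_iff_le,
      leafMap_leafCoord, leafMap_leafCoord]

theorem toOrderIso_apply (p : TreePair) (x : Icc (0 : ℝ) 1) :
    (p.toOrderIso x : ℝ) = leafMap p.target (leafCoord p.source x) := rfl

theorem isDyadicPL_toOrderIso (p : TreePair) : IsDyadicPL p.toOrderIso := by
  classical
  have hmem : ∀ i : ℕ, i ≤ p.source.numLeaves → leafMap p.source i ∈ Icc (0 : ℝ) 1 := by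
    intro i hi
    constructor
    · rw [← leafMap_zero p.source, (leafMap_strictMono _).le_iff_le]; positivity
    · rw [← leafMap_numLeaves p.source, (leafMap_strictMono _).le_iff_le]; exact_mod_cast hi
  refine ⟨(Finset.range (p.source.numLeaves + 1)).attach.image
    fun i => ⟨leafMap p.source i.1, hmem i.1 (by have := Finset.mem_range.1 i.2; omega)⟩, ?_, ?_⟩
  · intro d hd
    obtain ⟨i, _, rfl⟩ := Finset.mem_image.1 hd
    refine ⟨leafMap_dyadic _ _, ?_⟩
    rw [toOrderIso_apply, leafCoord_leafMap]
    exact leafMap_dyadic _ _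
  · intro a b hab h
    set u := leafCoord p.source a with hu
    set v := leafCoord p.source b with hv
    have hau : leafMap p.source u = a := leafMap_leafCoord _ _
    have hbv : leafMap p.source v = b := leafMap_leafCoord _ _
    have huv : u < v := by
      rw [← (leafMap_strictMono p.source).lt_iff_lt, hau, hbv]; exact hab
    have hu0 : 0 ≤ u := by
      rw [← (leafMap_strictMono p.source).le_iff_le, hau, leafMap_zero]; exact a.2.1
    have hvN : v ≤ p.source.numLeaves := by
      rw [← (leafMap_strictMono p.source).le_iff_le, hbv, leafMap_numLeaves]; exact b.2.2
    have hdis : ∀ i : ℕ, i ≤ p.source.numLeaves → (i : ℝ) ≤ u ∨ v ≤ i := by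
      intro i hi
      have := h ⟨leafMap p.source i, hmem i hi⟩
        (Finset.mem_image.2 ⟨⟨i, Finset.mem_range.2 (by omega)⟩, Finset.mem_attach _ _, rfl⟩)
      rw [← Subtype.coe_le_coe, ← Subtype.coe_le_coe] at this
      simp only [← hau, ← hbv] at this
      rwa [(leafMap_strictMono _).le_iff_le, (leafMap_strictMono _).le_iff_le] at this
    have hi1 : (⌊u⌋₊ : ℝ) ≤ u := Nat.floor_le hu0
    have hi2 : u < ⌊u⌋₊ + 1 := Nat.lt_floor_add_one u
    have hiN : ⌊u⌋₊ < p.source.numLeaves := by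
      have : (⌊u⌋₊ : ℝ) < p.source.numLeaves := by linarith
      exact_mod_cast this
    have hv1 : v ≤ ⌊u⌋₊ + 1 := by
      rcases hdis (⌊u⌋₊ + 1) hiN with h1 | h1
      · push_cast at h1; linarith
      · push_cast at h1; exact h1
    obtain ⟨n, c, hn⟩ := leafMap_affine p.source _ hiN
    obtain ⟨m, e, hm⟩ := leafMap_affine p.target _ (p.numLeaves_eq ▸ hiN)
    refine ⟨m - n, e - 2 ^ (m - n) * c, fun x hx => ?_⟩
    set w := leafCoord p.source x with hw
    have hxw : leafMap p.source w = x := leafMap_leafCoord _ _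
    have hw1 : u ≤ w := by
      rw [← (leafMap_strictMono p.source).le_iff_le, hau, hxw]; exact hx.1
    have hw2 : w ≤ v := by
      rw [← (leafMap_strictMono p.source).le_iff_le, hbv, hxw]; exact hx.2
    have hwI : w ∈ Icc (⌊u⌋₊ : ℝ) (⌊u⌋₊ + 1) := ⟨by linarith, by linarith⟩
    rw [toOrderIso_apply, ← hw, hm w hwI, ← hxw, hn w hwI, zpow_sub₀ (by norm_num)]
    have h2 : (2 : ℝ) ^ n ≠ 0 := by positivity
    field_simp
    ring

/-- The element of Thompson's group `F` represented by a tree pair. -/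
def toF (p : TreePair) : ThompsonF := ⟨p.toOrderIso, p.isDyadicPL_toOrderIso⟩

end TreePair

/-- The numbers `k` such that the leaves numbered `k` and `k + 1` (from left to right, starting
with `0`) are the two leaves of one caret, i.e. of an exposed caret. -/
def exposedCarets : BinaryTree Unit → Finset ℕ
  | .nil => ∅
  | .node _ .nil .nil => {0}
  | .node _ l r => exposedCarets l ∪ (exposedCarets r).image (· + l.numLeaves)

/-- A tree pair is reduced if it is non-empty (it has at least one caret) and, in case it has at
least two carets, there is no `k` such that each of the two trees has a caret with leaves `k` and
`k + 1`.  The pair of two single carets counts as reduced; it represents the identity. -/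
def TreePair.IsReduced (p : TreePair) : Prop :=
  1 ≤ p.size ∧ (2 ≤ p.size → Disjoint (exposedCarets p.source) (exposedCarets p.target))

/-- The set `X` of (non-empty) reduced tree pairs. -/
def ReducedTreePair : Type := {p : TreePair // p.IsReduced}

namespace ReducedTreePair

/-- The number of carets in either tree. -/
def size (t : ReducedTreePair) : ℕ := t.1.size

/-- The element of `F` represented by a reduced tree pair. -/
def toF (t : ReducedTreePair) : ThompsonF := t.1.toF

end ReducedTreePair

/-! ### The sum stratification and the spectrum

`X_k`, the set of unordered `k`-tuples of reduced tree pairs (repetitions allowed), is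
`Sym ReducedTreePair k`. -/

/-- The sphere of radius `n` of the sum stratification: the unordered `k`-tuples with a total of
`n` carets. -/
def sphSum (k n : ℕ) : Set (Sym ReducedTreePair k) :=
  {M | ((M : Multiset ReducedTreePair).map ReducedTreePair.size).sum = n}

/-- The subgroup of `F` generated by the coordinates of a `k`-tuple. -/
def generatedSubgroup {k : ℕ} (M : Sym ReducedTreePair k) : Subgroup ThompsonF :=
  Subgroup.closure {g | ∃ t ∈ M, t.toF = g}

/-- `T_H`: the `k`-tuples whose coordinates generate a subgroup of `F` isomorphic to `H`. -/
def tuplesGenerating (k : ℕ) (H : Subgroup ThompsonF) : Set (Sym ReducedTreePair k) :=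
  {M | Nonempty (generatedSubgroup M ≃* H)}

/-- The proportion of the sphere of radius `n` that lies in `T`. -/
def sphSumRatio {k : ℕ} (T : Set (Sym ReducedTreePair k)) (n : ℕ) : ℝ :=
  ((T ∩ sphSum k n).ncard : ℝ) / ((sphSum k n).ncard : ℝ)

/-- `T` has asymptotic density `d` with respect to the sum stratification. -/
def HasSumDensity {k : ℕ} (T : Set (Sym ReducedTreePair k)) (d : ℝ) : Prop :=
  Tendsto (sphSumRatio T) atTop (𝓝 d)

/-- The lower asymptotic density of `T` with respect to the sum stratification. -/
def lowerSumDensity {k : ℕ} (T : Set (Sym ReducedTreePair k)) : ℝ :=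
  liminf (sphSumRatio T) atTop

/-- Where the asymptotic density exists, it is the lower asymptotic density. -/
theorem HasSumDensity.lowerSumDensity_eq {k : ℕ} {T : Set (Sym ReducedTreePair k)} {d : ℝ}
    (h : HasSumDensity T d) : lowerSumDensity T = d :=
  Tendsto.liminf_eq h

/-- The spheres are finite, so that the cardinalities in `sphSumRatio` are the true ones. -/
theorem sphSum_finite (k n : ℕ) : (sphSum k n).Finite := by
  have hX : {t : ReducedTreePair | t.size ≤ n}.Finite := by
    have hB : {b : BinaryTree Unit | b.numNodes ≤ n}.Finite := by
      refine ((Finset.range (n + 1)).biUnion BinaryTree.treesOfNumNodesEq).finite_toSet.subset ?_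
      intro b hb
      simp only [Finset.coe_biUnion, Set.mem_iUnion]
      exact ⟨b.numNodes, Finset.mem_coe.2 (Finset.mem_range.2 (Nat.lt_succ_of_le hb)),
        Finset.mem_coe.2 (BinaryTree.mem_treesOfNumNodesEq_numNodes b)⟩
    refine Set.Finite.of_finite_image ((hB.prod hB).subset ?_)
      (f := fun t : ReducedTreePair => (t.1.source, t.1.target)) ?_
    · rintro _ ⟨t, ht, rfl⟩
      exact ⟨ht, by
        change t.1.target.numNodes ≤ n
        rw [← t.1.numNodes_eq]; exact ht⟩
    · rintro ⟨⟨a, b, h⟩, _⟩ _ ⟨⟨a', b', h'⟩, _⟩ _ he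
      simp only [Prod.mk.injEq] at he
      obtain ⟨rfl, rfl⟩ := he
      rfl
  have hpi : (Set.pi Set.univ fun _ : Fin k => {t : ReducedTreePair | t.size ≤ n}).Finite :=
    Set.Finite.pi fun _ => hX
  refine (hpi.image fun v => (⟨Multiset.ofList (List.ofFn v), by simp⟩ :
    Sym ReducedTreePair k)).subset ?_
  rintro ⟨M, hM⟩ h
  induction M using Quotient.inductionOn with
  | _ L =>
    have hL : L.length = k := by simpa using hM
    subst hL
    refine ⟨fun i => L.get i, fun i _ => ?_, Subtype.ext (by simp)⟩
    have hs : (L.map ReducedTreePair.size).sum = n := by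
      have h' : (Multiset.map ReducedTreePair.size (L : Multiset ReducedTreePair)).sum = n := h
      rwa [Multiset.map_coe, Multiset.sum_coe] at h'
    change (L.get i).size ≤ n
    rw [← hs]
    exact List.single_le_sum (by simp) _ (List.mem_map_of_mem (List.get_mem L i))

/-- `Spec_k^sum(F)`: the subgroups `H` of `F` that are visible, i.e. for which the set of
`k`-tuples generating a subgroup isomorphic to `H` has positive (lower) asymptotic density with
respect to the sum stratification. -/
def specSum (k : ℕ) : Set (Subgroup ThompsonF) :=
  {H | 0 < lowerSumDensity (tuplesGenerating k H)}

end

/-! A nontrivial finitely generated H ≤ F has a nontrivial homomorphism to ℤ. If [0,c] is the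
largest initial segment fixed pointwise by the generators, the logarithm of the slope just to the
right of c is a homomorphism; were it trivial, the segment could be prolonged
(`exists_hom_int_ne_one`). Pad the generators with 1 to a k-tuple. The Euclidean algorithm and a
division turn it into a generating tuple g of H with a homomorphism ψ to ℤ that is 1 on one entry
g_i and 0 on the others. Now let F × F act on the two halves of [0,1]. For every f, the map x ↦ (x,
f^ψ(x)) embeds H, and its image is generated by (g_i, f) and the (g_j, 1) with j ≠ i
(`nonempty_closure_range_joinF_mulEquiv`). So one entry of the tuple carries an arbitrary f while
the isomorphism type stays that of H.

Let r_n be the number of reduced tree pairs of size n. If everything except the tree pair of f is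
fixed, this yields r_m tuples in the sphere of radius m + c, with c constant. The sphere itself has
at most a constant times r_m elements: the convolution of r with itself is O(r), because two pairs
can be hung below a common root caret, and r_{n+1} = O(r_n) (`exists_ncard_sphSum_le`,
`exists_numReduced_add_le`).

The bound r_{n+1} = O(r_n) is analytic. Inclusion–exclusion over common exposed carets gives, for n
≥ 2, r_n = ∑ (-1)^|A| catalan(n-|A|)², where A runs over the subsets of {0,…,n-1} without
neighbours. Squares of Catalan numbers are the moments of a positive measure on [0,16], so r_n is
the integral of a polynomial p_n with p_{n+2} = t(p_{n+1} - p_n). On [4,16] one has 0 ≤ p_{n+1} ≤ 16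
p_n, on [0,4] only |p_n| ≤ 5^n, but on [8,16] p_n ≥ 6^n; hence the part over [0,4] is negligible. -/

/-! ### Exposed carets and leaf expansions -/

/-- Resolves the overlapping patterns of `exposedCarets`; in the first alternative the root caret
itself is exposed. -/
theorem mem_exposedCarets_node {l r : BinaryTree Unit} {i : ℕ} :
    i ∈ exposedCarets (.node () l r) ↔
      (l = .nil ∧ r = .nil ∧ i = 0) ∨ i ∈ exposedCarets l ∨
        (l.numLeaves ≤ i ∧ i - l.numLeaves ∈ exposedCarets r) := by
  have aux : i ∈ exposedCarets l ∪ (exposedCarets r).image (· + l.numLeaves) ↔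
      i ∈ exposedCarets l ∨ (l.numLeaves ≤ i ∧ i - l.numLeaves ∈ exposedCarets r) := by
    simp only [Finset.mem_union, Finset.mem_image]
    refine or_congr_right ⟨?_, ?_⟩
    · rintro ⟨a, ha, rfl⟩
      simpa using ha
    · rintro ⟨h, h'⟩
      exact ⟨_, h', by omega⟩
  cases l with
  | nil =>
    cases r with
    | nil => simp [exposedCarets]
    | node _ _ _ =>
      refine (Eq.to_iff ?_).trans (aux.trans ?_)
      · conv_lhs => rw [exposedCarets.eq_def]
      · simp
  | node _ _ _ =>
    refine (Eq.to_iff ?_).trans (aux.trans ?_)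
    · rw [exposedCarets]; simp
    · simp

theorem succ_lt_numLeaves_of_mem_exposedCarets {t : BinaryTree Unit} {i : ℕ}
    (h : i ∈ exposedCarets t) : i + 1 < t.numLeaves := by
  induction t generalizing i with
  | nil => simp [exposedCarets] at h
  | node _ l r hl hr =>
    simp only [BinaryTree.numLeaves]
    rcases mem_exposedCarets_node.1 h with ⟨rfl, rfl, rfl⟩ | h | ⟨h, h'⟩
    · simp [BinaryTree.numLeaves]
    · have := hl h; omega
    · have := hr h'; omega

theorem exposedCarets_subset_range (t : BinaryTree Unit) :
    exposedCarets t ⊆ Finset.range t.numNodes := fun i hi => by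
  have := succ_lt_numLeaves_of_mem_exposedCarets hi
  rw [t.numLeaves_eq_numNodes_succ] at this
  exact Finset.mem_range.2 (by omega)

theorem succ_notMem_exposedCarets {t : BinaryTree Unit} {i : ℕ}
    (h : i ∈ exposedCarets t) : i + 1 ∉ exposedCarets t := by
  induction t generalizing i with
  | nil => simp [exposedCarets] at h
  | node _ l r hl hr =>
    intro h2
    rcases mem_exposedCarets_node.1 h with ⟨rfl, rfl, rfl⟩ | h | ⟨h, h'⟩
    · simp [exposedCarets] at h2
    · have h3 := succ_lt_numLeaves_of_mem_exposedCarets h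
      rcases mem_exposedCarets_node.1 h2 with ⟨rfl, rfl, h2⟩ | h2 | ⟨h2, h2'⟩
      · omega
      · exact hl h h2
      · omega
    · rcases mem_exposedCarets_node.1 h2 with ⟨rfl, rfl, h2⟩ | h2 | ⟨h2, h2'⟩
      · omega
      · have h3 := succ_lt_numLeaves_of_mem_exposedCarets h2
        omega
      · rw [show i + 1 - l.numLeaves = i - l.numLeaves + 1 by omega] at h2'
        exact absurd h2' (hr h')

/-- Attach a caret to the leaf numbered `j`. -/
def expandLeaf : BinaryTree Unit → ℕ → BinaryTree Unit
  | .nil, _ => .node () .nil .nil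
  | .node _ l r, j =>
      if j < l.numLeaves then .node () (expandLeaf l j) r
      else .node () l (expandLeaf r (j - l.numLeaves))

theorem numNodes_expandLeaf (t : BinaryTree Unit) (j : ℕ) :
    (expandLeaf t j).numNodes = t.numNodes + 1 := by
  induction t generalizing j with
  | nil => rfl
  | node _ l r hl hr =>
    simp only [expandLeaf]
    split_ifs
    · simp only [BinaryTree.numNodes, hl]; omega
    · simp only [BinaryTree.numNodes, hr]; omega

theorem numLeaves_expandLeaf (t : BinaryTree Unit) (j : ℕ) :
    (expandLeaf t j).numLeaves = t.numLeaves + 1 := by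
  simp [BinaryTree.numLeaves_eq_numNodes_succ, numNodes_expandLeaf]

theorem expandLeaf_ne_nil (t : BinaryTree Unit) (j : ℕ) : expandLeaf t j ≠ .nil := fun h => by
  have := numNodes_expandLeaf t j
  rw [h] at this
  simp [BinaryTree.numNodes] at this

theorem mem_exposedCarets_expandLeaf_self {t : BinaryTree Unit} {j : ℕ} (hj : j < t.numLeaves) :
    j ∈ exposedCarets (expandLeaf t j) := by
  induction t generalizing j with
  | nil =>
    have : j = 0 := by simpa [BinaryTree.numLeaves] using hj
    simp [expandLeaf, exposedCarets, this]
  | node _ l r hl hr =>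
    simp only [BinaryTree.numLeaves] at hj
    simp only [expandLeaf]
    split_ifs with h
    · exact mem_exposedCarets_node.2 (Or.inr (Or.inl (hl h)))
    · exact mem_exposedCarets_node.2 (Or.inr (Or.inr ⟨not_lt.1 h, hr (by omega)⟩))

/-- A caret attached to the right of the leaves i and i + 1 neither renumbers nor covers them. -/
theorem mem_exposedCarets_expandLeaf_of_lt {t : BinaryTree Unit} {i j : ℕ} (hj : j < t.numLeaves)
    (hij : i + 1 < j) : i ∈ exposedCarets (expandLeaf t j) ↔ i ∈ exposedCarets t := by
  induction t generalizing i j with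
  | nil => simp [BinaryTree.numLeaves] at hj; omega
  | node _ l r hl hr =>
    simp only [BinaryTree.numLeaves] at hj
    simp only [expandLeaf]
    split_ifs with h
    · have h1 : ¬ (l = .nil) := by
        rintro rfl
        simp [BinaryTree.numLeaves] at h; omega
      rw [mem_exposedCarets_node, mem_exposedCarets_node, hl h hij, numLeaves_expandLeaf]
      simp only [h1, expandLeaf_ne_nil, false_and, false_or]
      refine or_congr_right ⟨fun h' => ?_, fun h' => ?_⟩ <;> omega
    · have h2 : ¬ (l = .nil ∧ r = .nil ∧ i = 0) := by
        rintro ⟨rfl, rfl, rfl⟩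
        simp [BinaryTree.numLeaves] at hj; omega
      rw [mem_exposedCarets_node, mem_exposedCarets_node]
      simp only [h2, expandLeaf_ne_nil, false_and, and_false, false_or]
      refine or_congr_right (and_congr_right fun h' => hr (by omega) (by omega))

theorem expandLeaf_injective {t t' : BinaryTree Unit} {j : ℕ} (hj : j < t.numLeaves)
    (hj' : j < t'.numLeaves) (h : expandLeaf t j = expandLeaf t' j) : t = t' := by
  induction t generalizing j t' with
  | nil =>
    have := congrArg BinaryTree.numNodes h
    rw [numNodes_expandLeaf, numNodes_expandLeaf] at this
    cases t' with
    | nil => rfl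
    | node _ _ _ => simp [BinaryTree.numNodes] at this
  | node _ l r hl hr =>
    cases t' with
    | nil =>
      have := congrArg BinaryTree.numNodes h
      rw [numNodes_expandLeaf, numNodes_expandLeaf] at this
      simp [BinaryTree.numNodes] at this
    | node _ l' r' =>
      simp only [BinaryTree.numLeaves] at hj hj'
      simp only [expandLeaf] at h
      split_ifs at h with h1 h2 h2
      · simp only [BinaryTree.node.injEq, true_and] at h
        rw [hl h1 h2 h.1, h.2]
      · simp only [BinaryTree.node.injEq, true_and] at h
        have := numLeaves_expandLeaf l j
        rw [h.1] at this; omega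
      · simp only [BinaryTree.node.injEq, true_and] at h
        have := numLeaves_expandLeaf l' j
        rw [← h.1] at this; omega
      · simp only [BinaryTree.node.injEq, true_and] at h
        obtain ⟨rfl, h⟩ := h
        rw [hr (by omega) (by omega) h]

theorem exists_expandLeaf_eq {t : BinaryTree Unit} {j : ℕ} (h : j ∈ exposedCarets t) :
    ∃ s : BinaryTree Unit, j < s.numLeaves ∧ expandLeaf s j = t := by
  induction t generalizing j with
  | nil => simp [exposedCarets] at h
  | node _ l r hl hr =>
    rcases mem_exposedCarets_node.1 h with ⟨rfl, rfl, rfl⟩ | h | ⟨hlj, h'⟩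
    · exact ⟨.nil, by simp [BinaryTree.numLeaves], rfl⟩
    · obtain ⟨s, hs, rfl⟩ := hl h
      exact ⟨.node () s r, by simp only [BinaryTree.numLeaves]; omega, by simp [expandLeaf, hs]⟩
    · obtain ⟨s, hs, rfl⟩ := hr h'
      exact ⟨.node () l s, by simp only [BinaryTree.numLeaves]; omega,
        by simp [expandLeaf, not_lt.2 hlj]⟩

/-- The map that compresses `[j,j+2]` to `[j,j+1]`. -/
noncomputable def compressAt (j : ℕ) (x : ℝ) : ℝ :=
  if x ≤ j then x else if x ≤ j + 2 then j + (x - j) / 2 else x - 1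

/-- The new caret bisects the interval of leaf j and shifts the later leaves by one. The bounds on x
are needed because the slopes outside the leaf range can change. -/
theorem leafMap_expandLeaf {t : BinaryTree Unit} {j : ℕ} (hj : j < t.numLeaves) {x : ℝ}
    (h0 : 0 ≤ x) (h1 : x ≤ t.numLeaves + 1) :
    leafMap (expandLeaf t j) x = leafMap t (compressAt j x) := by
  induction t generalizing j x with
  | nil =>
    have : j = 0 := by simpa [BinaryTree.numLeaves] using hj
    subst this
    simp only [BinaryTree.numLeaves, Nat.cast_one] at h1
    simp only [expandLeaf, leafMap, BinaryTree.numLeaves, compressAt]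
    push_cast
    split_ifs <;> linarith
  | node _ l r hl hr =>
    simp only [BinaryTree.numLeaves, Nat.cast_add] at hj h1
    simp only [expandLeaf]
    split_ifs with h
    · have hjl : (j : ℝ) + 1 ≤ l.numLeaves := by exact_mod_cast h
      by_cases hx : x ≤ l.numLeaves + 1
      · have hc : compressAt j x ≤ l.numLeaves := by
          simp only [compressAt]; split_ifs <;> linarith
        simp only [leafMap, numLeaves_expandLeaf, Nat.cast_add, Nat.cast_one, if_pos hx, if_pos hc,
          hl h h0 hx]
      · have hc : compressAt j x = x - 1 := by
          simp only [compressAt]; split_ifs <;> linarith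
        have hc' : ¬ (x - 1 ≤ l.numLeaves) := by linarith
        simp only [leafMap, numLeaves_expandLeaf, Nat.cast_add, Nat.cast_one, if_neg hx, hc,
          if_neg hc']
        congr 3
        ring
    · have hjl : (l.numLeaves : ℝ) ≤ j := by exact_mod_cast not_lt.1 h
      by_cases hx : x ≤ l.numLeaves
      · have hc : compressAt j x = x := by
          simp only [compressAt]; split_ifs <;> linarith
        simp only [leafMap, if_pos hx, hc]
      · have hc : ¬ (compressAt j x ≤ l.numLeaves) := by
          simp only [compressAt]; split_ifs <;> linarith
        have hs : compressAt (j - l.numLeaves) (x - l.numLeaves) =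
            compressAt j x - l.numLeaves := by
          simp only [compressAt, Nat.cast_sub (not_lt.1 h)]
          split_ifs <;> linarith
        simp only [leafMap, if_neg hx, if_neg hc]
        rw [hr (by omega) (by linarith) (by linarith), hs]

theorem leafCoord_mem {t : BinaryTree Unit} {y : ℝ} (hy : y ∈ Icc (0 : ℝ) 1) :
    leafCoord t y ∈ Icc (0 : ℝ) t.numLeaves := by
  constructor
  · rw [← (leafMap_strictMono t).le_iff_le, leafMap_leafCoord, leafMap_zero]; exact hy.1
  · rw [← (leafMap_strictMono t).le_iff_le, leafMap_leafCoord, leafMap_numLeaves]; exact hy.2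

/-- Cancelling a common exposed caret does not change the homeomorphism: both leaf coordinates are
reparametrized by the same `compressAt j`. -/
theorem leafMap_leafCoord_expandLeaf {s t : BinaryTree Unit} (hst : s.numLeaves = t.numLeaves)
    {j : ℕ} (hj : j < s.numLeaves) {y : ℝ} (hy : y ∈ Icc (0 : ℝ) 1) :
    leafMap (expandLeaf t j) (leafCoord (expandLeaf s j) y) = leafMap t (leafCoord s y) := by
  have hw := leafCoord_mem (t := expandLeaf s j) hy
  rw [numLeaves_expandLeaf] at hw
  push_cast at hw
  have h1 := leafMap_expandLeaf hj hw.1 hw.2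
  rw [leafMap_leafCoord] at h1
  rw [leafMap_expandLeaf (hst ▸ hj) hw.1 (by rw [← hst]; exact hw.2)]
  conv_rhs => rw [h1, leafCoord_leafMap]

/-! ### Counting tree pairs without common exposed carets -/

open BinaryTree in
/-- The trees with `n` carets that have the exposed carets in `A`. -/
noncomputable def treesWithExposed (n : ℕ) (A : Finset ℕ) : Finset (BinaryTree Unit) :=
  {t ∈ treesOfNumNodesEq n | A ⊆ exposedCarets t}

theorem mem_treesWithExposed {n : ℕ} {A : Finset ℕ} {t : BinaryTree Unit} :
    t ∈ treesWithExposed n A ↔ t.numNodes = n ∧ A ⊆ exposedCarets t := by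
  simp [treesWithExposed, BinaryTree.mem_treesOfNumNodesEq]

/-- Sets of natural numbers without two consecutive elements. -/
def IsSeparated (A : Finset ℕ) : Prop := ∀ i ∈ A, i + 1 ∉ A

instance : DecidablePred IsSeparated := fun A => by unfold IsSeparated; infer_instance

theorem card_treesWithExposed_of_not_isSeparated {n : ℕ} {A : Finset ℕ} (hA : ¬ IsSeparated A) :
    (treesWithExposed n A).card = 0 := by
  rw [Finset.card_eq_zero, Finset.eq_empty_iff_forall_notMem]
  intro t ht
  simp only [IsSeparated, not_forall, not_not] at hA
  obtain ⟨i, hi, hi'⟩ := hA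
  have := (mem_treesWithExposed.1 ht).2
  exact succ_notMem_exposedCarets (this hi) (this hi')

/-- Contracting the caret at j is a bijection; the carets in A lie to its left and keep their
numbers. -/
theorem card_treesWithExposed_insert {n j : ℕ} {A : Finset ℕ} (hj : j ≤ n)
    (hA : ∀ i ∈ A, i + 1 < j) :
    (treesWithExposed (n + 1) (insert j A)).card = (treesWithExposed n A).card := by
  symm
  refine Finset.card_bij (fun t _ => expandLeaf t j) ?_ ?_ ?_
  · intro t ht
    obtain ⟨hn, h⟩ := mem_treesWithExposed.1 ht
    have hjt : j < t.numLeaves := by rw [t.numLeaves_eq_numNodes_succ]; omega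
    refine mem_treesWithExposed.2 ⟨by rw [numNodes_expandLeaf, hn], fun i hi => ?_⟩
    rcases Finset.mem_insert.1 hi with rfl | hi
    · exact mem_exposedCarets_expandLeaf_self hjt
    · exact (mem_exposedCarets_expandLeaf_of_lt hjt (hA i hi)).2 (h hi)
  · intro t ht t' ht' he
    have hn := (mem_treesWithExposed.1 ht).1
    have hn' := (mem_treesWithExposed.1 ht').1
    exact expandLeaf_injective (by rw [t.numLeaves_eq_numNodes_succ]; omega)
      (by rw [t'.numLeaves_eq_numNodes_succ]; omega) he
  · intro t ht
    obtain ⟨hn, h⟩ := mem_treesWithExposed.1 ht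
    obtain ⟨s, hs, rfl⟩ := exists_expandLeaf_eq (h (Finset.mem_insert_self _ _))
    rw [numNodes_expandLeaf] at hn
    refine ⟨s, mem_treesWithExposed.2 ⟨by omega, fun i hi => ?_⟩, rfl⟩
    exact (mem_exposedCarets_expandLeaf_of_lt hs (hA i hi)).1 (h (Finset.mem_insert_of_mem hi))

/-- Contract the carets of A from right to left, losing one caret each time; an arbitrary tree with
n - |A| carets remains. -/
theorem card_treesWithExposed {n : ℕ} {A : Finset ℕ} (hA : IsSeparated A)
    (hn : A ⊆ Finset.range n) : (treesWithExposed n A).card = catalan (n - A.card) := by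
  induction A using Finset.induction_on_max generalizing n with
  | empty => simp [treesWithExposed, BinaryTree.treesOfNumNodesEq_card_eq_catalan]
  | insert j A hmax ih =>
    have hjn : j < n := Finset.mem_range.1 (hn (Finset.mem_insert_self _ _))
    obtain ⟨n, rfl⟩ : ∃ n', n = n' + 1 := ⟨n - 1, by omega⟩
    have hsep : ∀ i ∈ A, i + 1 < j := fun i hi => by
      have h1 := hmax i hi
      have h2 := hA i (Finset.mem_insert_of_mem hi)
      have : i + 1 ≠ j := by
        rintro rfl
        exact h2 (Finset.mem_insert_self _ _)
      omega
    rw [card_treesWithExposed_insert (by omega) hsep, ih, Finset.card_insert_of_notMem,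
      Nat.add_sub_add_right]
    · exact fun h => lt_irrefl _ (hmax j h)
    · exact fun i hi h => hA i (Finset.mem_insert_of_mem hi) (Finset.mem_insert_of_mem h)
    · intro i hi
      have := hsep i hi
      exact Finset.mem_range.2 (by omega)

open BinaryTree in
/-- The pairs of trees with `n` carets that have no common exposed caret. -/
noncomputable def disjointPairs (n : ℕ) : Finset (BinaryTree Unit × BinaryTree Unit) :=
  {p ∈ treesOfNumNodesEq n ×ˢ treesOfNumNodesEq n |
    Disjoint (exposedCarets p.1) (exposedCarets p.2)}

theorem mem_disjointPairs {n : ℕ} {p : BinaryTree Unit × BinaryTree Unit} :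
    p ∈ disjointPairs n ↔ p.1.numNodes = n ∧ p.2.numNodes = n ∧
      Disjoint (exposedCarets p.1) (exposedCarets p.2) := by
  simp [disjointPairs, BinaryTree.mem_treesOfNumNodesEq, and_assoc]

open BinaryTree in
-- Inclusion–exclusion over sets A of common exposed carets. Sets with two neighbours contribute
-- nothing, since distinct exposed carets share no leaf.
theorem card_disjointPairs (n : ℕ) :
    ((disjointPairs n).card : ℤ) =
      ∑ A ∈ (Finset.range n).powerset with IsSeparated A,
        (-1) ^ A.card * (catalan (n - A.card) : ℤ) ^ 2 := by
  have h1 : ((disjointPairs n).card : ℤ) =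
      ∑ p ∈ treesOfNumNodesEq n ×ˢ treesOfNumNodesEq n,
        ∑ A ∈ (Finset.range n).powerset,
          if A ⊆ exposedCarets p.1 ∩ exposedCarets p.2 then (-1 : ℤ) ^ A.card else 0 := by
    rw [disjointPairs, Finset.card_filter]
    push_cast
    refine Finset.sum_congr rfl fun p hp => ?_
    have hp1 : p.1.numNodes = n := mem_treesOfNumNodesEq.1 (Finset.mem_product.1 hp).1
    rw [← Finset.sum_filter]
    have : {A ∈ (Finset.range n).powerset | A ⊆ exposedCarets p.1 ∩ exposedCarets p.2} =
        (exposedCarets p.1 ∩ exposedCarets p.2).powerset := by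
      ext A
      simp only [Finset.mem_filter, Finset.mem_powerset, and_iff_right_iff_imp]
      intro h
      exact (h.trans Finset.inter_subset_left).trans (hp1 ▸ exposedCarets_subset_range p.1)
    rw [this, Finset.sum_powerset_neg_one_pow_card]
    simp [Finset.disjoint_iff_inter_eq_empty]
  rw [h1, Finset.sum_comm, Finset.sum_filter]
  refine Finset.sum_congr rfl fun A hA => ?_
  have h2 : ∑ p ∈ treesOfNumNodesEq n ×ˢ treesOfNumNodesEq n,
      (if A ⊆ exposedCarets p.1 ∩ exposedCarets p.2 then (-1 : ℤ) ^ A.card else 0) =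
      (-1) ^ A.card * ((treesWithExposed n A).card : ℤ) ^ 2 := by
    rw [← Finset.sum_filter, Finset.sum_const, nsmul_eq_mul, mul_comm, sq, ← Nat.cast_mul,
      ← Finset.card_product]
    congr 3
    ext p
    simp only [Finset.mem_filter, Finset.mem_product, mem_treesWithExposed,
      mem_treesOfNumNodesEq, Finset.subset_inter_iff]
    tauto
  rw [h2]
  split_ifs with hs
  · rw [card_treesWithExposed hs (Finset.mem_powerset.1 hA)]
  · rw [card_treesWithExposed_of_not_isSeparated hs]; simp

/-! ### The growth of the number of tree pairs without common exposed carets -/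

open Real in
-- Wallis' product, matched with the recursion of the central binomial coefficients.
theorem four_pow_mul_integral_sin_pow (n : ℕ) :
    4 ^ n * ∫ x in (0 : ℝ)..π, sin x ^ (2 * n) = π * n.centralBinom := by
  rw [integral_sin_pow_even]
  induction n with
  | zero => simp
  | succ n ih =>
    have h : ((n : ℝ) + 1) * (n + 1).centralBinom = 2 * (2 * n + 1) * n.centralBinom := by
      exact_mod_cast Nat.succ_mul_centralBinom_succ n
    have h0 : (n : ℝ) + 1 ≠ 0 := by positivity
    have h' : ((n + 1).centralBinom : ℝ) = 2 * (2 * n + 1) * n.centralBinom / (n + 1) := by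
      rw [← h]; field_simp
    rw [Finset.prod_range_succ, h', pow_succ]
    calc _ = 4 * ((2 * n + 1) / (2 * n + 2)) *
          (4 ^ n * (π * ∏ i ∈ Finset.range n, (2 * (i : ℝ) + 1) / (2 * i + 2))) := by ring
      _ = _ := by
        rw [ih]
        have : (2 * (n : ℝ) + 2) ≠ 0 := by positivity
        field_simp
        ring

open Real in
/-- The Catalan numbers are the moments of a positive measure on `[0,4]`. -/
theorem catalan_eq_integral (n : ℕ) :
    (catalan n : ℝ) = ∫ x in (0 : ℝ)..π, 2 / π * cos x ^ 2 * (4 * sin x ^ 2) ^ n := by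
  have h1 := four_pow_mul_integral_sin_pow n
  have h2 := four_pow_mul_integral_sin_pow (n + 1)
  have hsin : ∀ k : ℕ, IntervalIntegrable (fun x => sin x ^ k) MeasureTheory.volume 0 π :=
    fun k => (by fun_prop : Continuous fun x => sin x ^ k).intervalIntegrable _ _
  have h3 : ∀ x, 2 / π * cos x ^ 2 * (4 * sin x ^ 2) ^ n =
      2 / π * 4 ^ n * (sin x ^ (2 * n) - sin x ^ (2 * (n + 1))) := fun x => by
    rw [cos_sq', mul_pow, ← pow_mul]
    ring
  simp only [h3]
  rw [intervalIntegral.integral_const_mul, intervalIntegral.integral_sub (hsin _) (hsin _)]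
  have hb : ((n : ℝ) + 1) * (n + 1).centralBinom = 2 * (2 * n + 1) * n.centralBinom := by
    exact_mod_cast Nat.succ_mul_centralBinom_succ n
  have hc : ((n : ℝ) + 1) * catalan n = n.centralBinom := by
    exact_mod_cast succ_mul_catalan_eq_centralBinom n
  have h0 : (n : ℝ) + 1 ≠ 0 := by positivity
  have hpi : π ≠ 0 := pi_ne_zero
  have h4 : 2 / π * 4 ^ n * ((∫ x in (0 : ℝ)..π, sin x ^ (2 * n)) -
      ∫ x in (0 : ℝ)..π, sin x ^ (2 * (n + 1))) =
      2 / π * ((4 ^ n * ∫ x in (0 : ℝ)..π, sin x ^ (2 * n)) -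
        (4 ^ (n + 1) * ∫ x in (0 : ℝ)..π, sin x ^ (2 * (n + 1))) / 4) := by ring
  rw [h4, h1, h2]
  have h5 : ((n + 1).centralBinom : ℝ) = 2 * (2 * n + 1) * catalan n := by
    apply mul_left_cancel₀ h0
    rw [hb, ← hc]; ring
  rw [h5, ← hc]
  field_simp
  ring

open Real in
-- The sum is the integral of the polynomial at 4 sin² x ∈ [0,4] against the nonnegative weight
-- (2/π) cos² x.
theorem sum_mul_catalan_nonneg (N : ℕ) (a : ℕ → ℝ)
    (h : ∀ t ∈ Icc (0 : ℝ) 4, 0 ≤ ∑ j ∈ Finset.range N, a j * t ^ j) :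
    0 ≤ ∑ j ∈ Finset.range N, a j * catalan j := by
  have h1 : ∑ j ∈ Finset.range N, a j * (catalan j : ℝ) =
      ∫ x in (0 : ℝ)..π, ∑ j ∈ Finset.range N,
        a j * (2 / π * cos x ^ 2 * (4 * sin x ^ 2) ^ j) := by
    rw [intervalIntegral.integral_finsetSum]
    · refine Finset.sum_congr rfl fun j _ => ?_
      rw [intervalIntegral.integral_const_mul, ← catalan_eq_integral]
    · intro j _
      exact Continuous.intervalIntegrable (by fun_prop) _ _
  rw [h1]
  refine intervalIntegral.integral_nonneg pi_pos.le fun x _ => ?_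
  have h2 := h (4 * sin x ^ 2) ⟨by positivity, by nlinarith [sin_sq_le_one x]⟩
  have h3 : ∑ j ∈ Finset.range N, a j * (2 / π * cos x ^ 2 * (4 * sin x ^ 2) ^ j) =
      2 / π * cos x ^ 2 * ∑ j ∈ Finset.range N, a j * (4 * sin x ^ 2) ^ j := by
    rw [Finset.mul_sum]
    exact Finset.sum_congr rfl fun j _ => by ring
  rw [h3]
  have := pi_pos
  positivity

/-- The product of two independent variables with the Catalan numbers as moments lies in [0,16] and
has their squares as moments. Here the two integrations are two applications of the one-variable
statement to the polynomial at s * t. -/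
theorem sum_mul_catalan_sq_nonneg (N : ℕ) (a : ℕ → ℝ)
    (h : ∀ t ∈ Icc (0 : ℝ) 16, 0 ≤ ∑ j ∈ Finset.range N, a j * t ^ j) :
    0 ≤ ∑ j ∈ Finset.range N, a j * (catalan j : ℝ) ^ 2 := by
  have h1 := sum_mul_catalan_nonneg N (fun j => a j * catalan j) fun s hs => by
    have := sum_mul_catalan_nonneg N (fun j => a j * s ^ j) fun t ht => by
      have := h (s * t) ⟨mul_nonneg hs.1 ht.1, by nlinarith [hs.1, hs.2, ht.1, ht.2]⟩
      simpa only [mul_pow, mul_assoc] using this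
    simpa only [mul_right_comm] using this
  simpa only [sq, mul_assoc] using h1

section

open Polynomial

/-- The linear functional on polynomials that sends `X ^ j` to the square of the `j`-th Catalan
number. -/
noncomputable def catalanSqFunctional : ℝ[X] →ₗ[ℝ] ℝ :=
  Polynomial.lsum fun j => (catalan j : ℝ) ^ 2 • LinearMap.id

theorem catalanSqFunctional_X_pow (j : ℕ) :
    catalanSqFunctional (X ^ j) = (catalan j : ℝ) ^ 2 := by
  rw [catalanSqFunctional, Polynomial.lsum_apply, ← Polynomial.monomial_one_right_eq_X_pow,
    Polynomial.sum_monomial_index] <;> simp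

theorem catalanSqFunctional_C (a : ℝ) : catalanSqFunctional (C a) = a := by
  have := catalanSqFunctional_X_pow 0
  rw [← mul_one (C a), ← smul_eq_C_mul, map_smul, ← pow_zero X, this]
  simp

theorem catalanSqFunctional_nonneg {p : ℝ[X]} (h : ∀ t ∈ Icc (0 : ℝ) 16, 0 ≤ p.eval t) :
    0 ≤ catalanSqFunctional p := by
  have h1 : catalanSqFunctional p =
      ∑ j ∈ Finset.range (p.natDegree + 1), p.coeff j * (catalan j : ℝ) ^ 2 := by
    rw [catalanSqFunctional, Polynomial.lsum_apply, Polynomial.sum_over_range]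
    · simp [mul_comm]
    · simp
  rw [h1]
  refine sum_mul_catalan_sq_nonneg _ _ fun t ht => ?_
  rw [← Polynomial.eval_eq_sum_range]
  exact h t ht

theorem catalanSqFunctional_mono {p q : ℝ[X]}
    (h : ∀ t ∈ Icc (0 : ℝ) 16, p.eval t ≤ q.eval t) :
    catalanSqFunctional p ≤ catalanSqFunctional q := by
  have := catalanSqFunctional_nonneg (p := q - p) fun t ht => by
    rw [eval_sub]; exact sub_nonneg.2 (h t ht)
  rwa [map_sub, sub_nonneg] at this

/-- The signed generating polynomial of the separated subsets of `{0, …, n - 1}`. -/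
noncomputable def separatedPoly (n : ℕ) : ℝ[X] :=
  ∑ A ∈ (Finset.range n).powerset with IsSeparated A, (-1) ^ A.card * X ^ (n - A.card)

theorem catalanSqFunctional_separatedPoly (n : ℕ) :
    catalanSqFunctional (separatedPoly n) = (disjointPairs n).card := by
  have h := congrArg (Int.cast (R := ℝ)) (card_disjointPairs n)
  push_cast at h
  rw [h, separatedPoly, map_sum]
  refine Finset.sum_congr rfl fun A _ => ?_
  rw [show ((-1 : ℝ[X]) ^ A.card) = C ((-1) ^ A.card) by simp, ← smul_eq_C_mul, map_smul,
    catalanSqFunctional_X_pow, smul_eq_mul]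

theorem isSeparated_insert_succ {n : ℕ} {A : Finset ℕ} (hA : A ⊆ Finset.range n) :
    IsSeparated (insert (n + 1) A) ↔ IsSeparated A := by
  have hn : ∀ i ∈ A, i < n := fun i hi => Finset.mem_range.1 (hA hi)
  constructor
  · exact fun h i hi h' => h i (Finset.mem_insert_of_mem hi) (Finset.mem_insert_of_mem h')
  · intro h i hi h'
    rw [Finset.mem_insert] at hi h'
    rcases hi with rfl | hi
    · rcases h' with h' | h'
      · omega
      · have := hn _ h'; omega
    · rcases h' with h' | h'
      · have := hn _ hi; omega
      · exact h i hi h'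

theorem separatedPoly_zero : separatedPoly 0 = 1 := by
  have : IsSeparated ∅ := by simp [IsSeparated]
  simp [separatedPoly, Finset.sum_filter, this]

theorem separatedPoly_one : separatedPoly 1 = X - 1 := by
  have h0 : IsSeparated ∅ := by simp [IsSeparated]
  have h1 : IsSeparated {0} := by simp [IsSeparated]
  rw [separatedPoly, Finset.sum_filter, Finset.range_one, ← insert_empty_eq,
    Finset.sum_powerset_insert (by simp)]
  simp [h0, h1]
  ring

/-- Split by whether n + 1 belongs to A. If it does, n does not, and the rest is an arbitrary
separated subset of {0,…,n-1}. -/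
theorem separatedPoly_add_two (n : ℕ) :
    separatedPoly (n + 2) = X * (separatedPoly (n + 1) - separatedPoly n) := by
  have hcard : ∀ {m : ℕ} {A : Finset ℕ}, A ∈ (Finset.range m).powerset → A.card ≤ m := by
    intro m A hA
    simpa using Finset.card_le_card (Finset.mem_powerset.1 hA)
  rw [separatedPoly, Finset.sum_filter, Finset.range_add_one,
    Finset.sum_powerset_insert (by simp), mul_sub, sub_eq_add_neg]
  congr 1
  · rw [separatedPoly, Finset.sum_filter, Finset.mul_sum]
    refine Finset.sum_congr rfl fun A hA => ?_
    split_ifs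
    · rw [show n + 2 - A.card = n + 1 - A.card + 1 by have := hcard hA; omega]
      ring
    · simp
  · rw [Finset.range_add_one, Finset.sum_powerset_insert (by simp), separatedPoly,
      Finset.sum_filter, Finset.mul_sum, ← Finset.sum_neg_distrib]
    rw [show ∑ A ∈ (Finset.range n).powerset,
        (if IsSeparated (insert (n + 1) (insert n A)) then
          (-1 : ℝ[X]) ^ (insert (n + 1) (insert n A)).card *
            X ^ (n + 2 - (insert (n + 1) (insert n A)).card) else 0) = 0 from ?_, add_zero]
    · refine Finset.sum_congr rfl fun A hA => ?_
      have hA' := Finset.mem_powerset.1 hA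
      have hn : n + 1 ∉ A := fun h => by have := Finset.mem_range.1 (hA' h); omega
      simp only [isSeparated_insert_succ hA', Finset.card_insert_of_notMem hn]
      split_ifs
      · rw [show n + 2 - (A.card + 1) = n - A.card + 1 by have := hcard hA; omega]
        ring
      · simp
    · refine Finset.sum_eq_zero fun A _ => if_neg fun h => ?_
      exact h n (by simp) (by simp)

theorem eval_separatedPoly_add_two (n : ℕ) (t : ℝ) :
    (separatedPoly (n + 2)).eval t =
      t * ((separatedPoly (n + 1)).eval t - (separatedPoly n).eval t) := by
  rw [separatedPoly_add_two]; simp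

/-- In absolute values the recursion grows at most like the root 2 + 2√2 < 5 of λ² = 4(λ + 1); the
induction needs 4(5 + 1) ≤ 25. -/
theorem abs_eval_separatedPoly_le {t : ℝ} (h0 : 0 ≤ t) (h4 : t ≤ 4) (n : ℕ) :
    |(separatedPoly n).eval t| ≤ 5 ^ n ∧ |(separatedPoly (n + 1)).eval t| ≤ 5 ^ (n + 1) := by
  induction n with
  | zero =>
    simp only [separatedPoly_zero, separatedPoly_one, zero_add, eval_one, eval_sub, eval_X, abs_le]
    norm_num
    constructor <;> linarith
  | succ n ih =>
    refine ⟨ih.2, ?_⟩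
    rw [eval_separatedPoly_add_two, abs_mul, abs_of_nonneg h0]
    have h1 := abs_sub ((separatedPoly (n + 1)).eval t) ((separatedPoly n).eval t)
    have h2 : (0 : ℝ) < 5 ^ n := by positivity
    calc _ ≤ 4 * (5 ^ (n + 1) + 5 ^ n : ℝ) :=
          mul_le_mul h4 (h1.trans (add_le_add ih.2 ih.1)) (abs_nonneg _) (by norm_num)
      _ ≤ _ := by rw [pow_succ, pow_succ, pow_succ]; linarith

/-- The ratio ρ of consecutive values evolves by ρ ↦ t(1 - 1/ρ), which preserves [2,t] when t ≥ 4.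
-/
theorem eval_separatedPoly_bounds {t : ℝ} (h4 : 4 ≤ t) (n : ℕ) :
    0 ≤ (separatedPoly n).eval t ∧
      2 * (separatedPoly n).eval t ≤ (separatedPoly (n + 1)).eval t ∧
      (separatedPoly (n + 1)).eval t ≤ t * (separatedPoly n).eval t := by
  induction n with
  | zero =>
    simp only [separatedPoly_zero, separatedPoly_one, zero_add, eval_one, eval_sub, eval_X]
    refine ⟨?_, ?_, ?_⟩ <;> linarith
  | succ n ih =>
    obtain ⟨h1, h2, h3⟩ := ih
    rw [eval_separatedPoly_add_two]
    refine ⟨by linarith, by nlinarith, by nlinarith⟩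

/-- For t ≥ 8 a ratio ρ ≥ 6 is followed by t(1 - 1/ρ) ≥ 20/3. -/
theorem six_pow_le_eval_separatedPoly {t : ℝ} (h8 : 8 ≤ t) (n : ℕ) :
    6 ^ n ≤ (separatedPoly n).eval t ∧
      6 * (separatedPoly n).eval t ≤ (separatedPoly (n + 1)).eval t := by
  induction n with
  | zero =>
    simp only [separatedPoly_zero, separatedPoly_one, zero_add, eval_one, eval_sub, eval_X]
    refine ⟨by norm_num, by linarith⟩
  | succ n ih =>
    obtain ⟨h1, h2⟩ := ih
    have h3 : (0 : ℝ) < 6 ^ n := by positivity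
    rw [eval_separatedPoly_add_two, pow_succ]
    refine ⟨by linarith, by nlinarith⟩

/-- On [4,16] the ratio of consecutive values is at most t ≤ 16; on [0,4] the error is at most
5^(n+1) + 16 · 5^n = 21 · 5^n. -/
theorem card_disjointPairs_succ_le_add (n : ℕ) :
    ((disjointPairs (n + 1)).card : ℝ) ≤ 16 * (disjointPairs n).card + 21 * 5 ^ n := by
  have h := catalanSqFunctional_mono (p := separatedPoly (n + 1))
    (q := (16 : ℝ) • separatedPoly n + C (21 * 5 ^ n)) fun t ht => by
      simp only [eval_add, eval_smul, eval_C, smul_eq_mul]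
      rcases le_total t 4 with h4 | h4
      · obtain ⟨h1, h2⟩ := abs_eval_separatedPoly_le ht.1 h4 n
        rw [pow_succ] at h2
        linarith [(abs_le.1 h1).1, (abs_le.1 h2).2]
      · obtain ⟨h1, h2, h3⟩ := eval_separatedPoly_bounds h4 n
        have := mul_le_mul_of_nonneg_right ht.2 h1
        have : (0 : ℝ) < 5 ^ n := by positivity
        linarith
  rwa [map_add, map_smul, catalanSqFunctional_C, catalanSqFunctional_separatedPoly,
    catalanSqFunctional_separatedPoly, smul_eq_mul] at h

/-- The polynomial is at least 6^n on [8,16] and at least -5^n elsewhere. The mass of [8,16] is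
bounded below by the test polynomial (t^13 - 8^13)/16^13, which is at most 0 on [0,8] and at most 1
on [8,16]. -/
theorem exists_mul_six_pow_le_card_disjointPairs :
    ∃ κ : ℝ, 0 < κ ∧ ∀ n, κ * 6 ^ n ≤ (disjointPairs n).card + 5 ^ n := by
  have hcat : catalan 13 = 742900 := by
    rw [catalan_eq_centralBinom_div, Nat.centralBinom_eq_two_mul_choose]
    norm_num [Nat.choose]
  -- The exponent 13 is the least j with `catalan j ^ 2 > 8 ^ j`, which makes this constant
  -- positive.
  refine ⟨(742900 ^ 2 - 8 ^ 13) / 16 ^ 13, by norm_num, fun n => ?_⟩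
  have h := catalanSqFunctional_mono (p := ((6 ^ n / 16 ^ 13 : ℝ)) • (X ^ 13 - C (8 ^ 13)))
    (q := separatedPoly n + C (5 ^ n)) fun t ht => by
      simp only [eval_add, eval_smul, eval_C, eval_sub, eval_pow, eval_X, smul_eq_mul]
      have h5 : (0 : ℝ) < 5 ^ n := by positivity
      have h6 : (0 : ℝ) < 6 ^ n / 16 ^ 13 := by positivity
      rcases le_total t 8 with h8 | h8
      · have h7 : t ^ 13 ≤ 8 ^ 13 := pow_le_pow_left₀ ht.1 h8 13
        have h9 : 6 ^ n / 16 ^ 13 * (t ^ 13 - 8 ^ 13) ≤ 0 :=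
          mul_nonpos_of_nonneg_of_nonpos h6.le (by linarith)
        rcases le_total t 4 with h4 | h4
        · linarith [(abs_le.1 (abs_eval_separatedPoly_le ht.1 h4 n).1).1]
        · linarith [(eval_separatedPoly_bounds h4 n).1]
      · have h7 : t ^ 13 ≤ 16 ^ 13 := pow_le_pow_left₀ ht.1 ht.2 13
        have h9 : 6 ^ n / 16 ^ 13 * (t ^ 13 - 8 ^ 13) ≤ 6 ^ n / 16 ^ 13 * 16 ^ 13 :=
          mul_le_mul_of_nonneg_left (by linarith [show (0 : ℝ) < 8 ^ 13 by norm_num]) h6.le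
        rw [div_mul_cancel₀ _ (by norm_num)] at h9
        linarith [(six_pow_le_eval_separatedPoly h8 n).1]
  rw [map_add, map_smul, map_sub, catalanSqFunctional_C, catalanSqFunctional_C,
    catalanSqFunctional_separatedPoly, catalanSqFunctional_X_pow, hcat, smul_eq_mul] at h
  refine le_trans (le_of_eq ?_) h
  push_cast
  ring

/-- Once κ 6^n > 2 · 5^n the count exceeds 5^n and absorbs the error term: 37 = 16 + 21. -/
theorem eventually_card_disjointPairs_succ_le :
    ∀ᶠ n in atTop, (disjointPairs (n + 1)).card ≤ 37 * (disjointPairs n).card := by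
  obtain ⟨κ, hκ, h⟩ := exists_mul_six_pow_le_card_disjointPairs
  have hlim : Tendsto (fun n : ℕ => ((5 : ℝ) / 6) ^ n) atTop (𝓝 0) :=
    tendsto_pow_atTop_nhds_zero_of_lt_one (by norm_num) (by norm_num)
  filter_upwards [hlim.eventually (gt_mem_nhds (half_pos hκ))] with n hn
  have h6 : (0 : ℝ) < 6 ^ n := by positivity
  rw [div_pow, div_lt_iff₀ h6] at hn
  have h1 := h n
  have h2 := card_disjointPairs_succ_le_add n
  have : ((disjointPairs (n + 1)).card : ℝ) ≤ 37 * (disjointPairs n).card := by linarith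
  exact_mod_cast this

end

/-! ### Every element of `F` is represented by a reduced tree pair -/

/-- A subdivision of `[0,1]` into standard dyadic intervals is the subdivision of a tree. -/
theorem exists_leafMap_eq (N : ℕ) (x : ℕ → ℝ) (h0 : x 0 = 0) (hN : x N = 1)
    (hx : ∀ i < N, ∃ (a : ℤ) (m : ℕ), x i = a / 2 ^ m ∧ x (i + 1) = (a + 1) / 2 ^ m) :
    ∃ t : BinaryTree Unit, t.numLeaves = N ∧ ∀ i ≤ N, leafMap t i = x i := by
  induction N using Nat.strong_induction_on generalizing x with
  | _ N ih =>
  have hstep : ∀ i < N, x i < x (i + 1) := fun i hi => by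
    obtain ⟨a, m, h1, h2⟩ := hx i hi
    rw [h1, h2]
    gcongr
    linarith
  have hmono : ∀ i j, i < j → j ≤ N → x i < x j := by
    intro i j hij
    induction j, hij using Nat.le_induction with
    | base => exact fun h => hstep i h
    | succ j _ ih' => exact fun h => (ih' (by omega)).trans (hstep j h)
  rcases Nat.lt_or_ge N 2 with hN2 | hN2
  · have hN1 : N = 1 := by
      rcases Nat.eq_zero_or_pos N with rfl | h
      · rw [h0] at hN; norm_num at hN
      · omega
    subst hN1
    refine ⟨.nil, rfl, fun i hi => ?_⟩
    rcases Nat.le_one_iff_eq_zero_or_eq_one.1 hi with rfl | rfl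
    · simp [leafMap, h0]
    · simp [leafMap, hN]
  -- An interval of length 1 would be all of [0,1], impossible with at least two pieces; so every
  -- piece has a denominator divisible by 2 and can be doubled.
  have hx' : ∀ i < N, ∃ (a : ℤ) (m : ℕ),
      x i = a / 2 ^ (m + 1) ∧ x (i + 1) = (a + 1) / 2 ^ (m + 1) := by
    intro i hi
    obtain ⟨a, m, h1, h2⟩ := hx i hi
    rcases m with _ | m
    · exfalso
      have h3 : x (i + 1) = x i + 1 := by rw [h1, h2]; simp
      rcases Nat.eq_zero_or_pos i with rfl | hi0
      · have := hmono 1 N (by omega) le_rfl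
        rw [zero_add] at h3
        linarith
      · have h4 := hmono 0 i hi0 hi.le
        rcases hi.nat_succ_le.eq_or_lt with h | h
        · rw [← h] at hN; simp only [Nat.succ_eq_add_one] at hN; linarith
        · have := hmono (i + 1) N h le_rfl
          linarith
    · exact ⟨a, m, h1, h2⟩
  classical
  have hex : ∃ k, 1 / 2 ≤ x k := ⟨N, by rw [hN]; norm_num⟩
  obtain ⟨k, hk1, hk2⟩ : ∃ k, 1 / 2 ≤ x k ∧ ∀ i < k, x i < 1 / 2 :=
    ⟨Nat.find hex, Nat.find_spec hex, fun i hi => not_le.1 (Nat.find_min hex hi)⟩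
  have hkN : k ≤ N := by
    by_contra h
    have := hk2 N (by omega)
    rw [hN] at this; norm_num at this
  have hk0 : k ≠ 0 := by
    rintro rfl
    rw [h0] at hk1; norm_num at hk1
  -- No standard dyadic interval of length at most 1/2 has 1/2 in its interior: a < 2^m ≤ a + 1
  -- forces a + 1 = 2^m.
  have hk : x k = 1 / 2 := by
    obtain ⟨i, rfl⟩ := Nat.exists_eq_succ_of_ne_zero hk0
    simp only [Nat.succ_eq_add_one] at *
    obtain ⟨a, m, h1, h2⟩ := hx' i (by omega)
    have h3 := hk2 i (by omega)
    have hp : (0 : ℝ) < 2 ^ m := by positivity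
    rw [h1, div_lt_iff₀ (by positivity), pow_succ] at h3
    rw [h2, le_div_iff₀ (by positivity), pow_succ] at hk1
    have h4 : (a : ℝ) < 2 ^ m := by linarith
    have h5 : (2 : ℝ) ^ m ≤ a + 1 := by linarith
    have h4' : a < 2 ^ m := by exact_mod_cast h4
    have h5' : (2 : ℤ) ^ m ≤ a + 1 := by exact_mod_cast h5
    have h6 : a + 1 = 2 ^ m := by omega
    have h6' : (a : ℝ) + 1 = 2 ^ m := by exact_mod_cast h6
    rw [h2, h6', pow_succ]
    field_simp
  have hkN' : k < N := by
    rcases hkN.eq_or_lt with rfl | h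
    · rw [hk] at hN; norm_num at hN
    · exact h
  obtain ⟨l, hl1, hl2⟩ := ih k hkN' (fun i => 2 * x i) (by simp [h0]) (by simp [hk])
    fun i hi => by
      obtain ⟨a, m, h1, h2⟩ := hx' i (by omega)
      refine ⟨a, m, ?_, ?_⟩
      · rw [h1, pow_succ]; field_simp
      · rw [h2, pow_succ]; field_simp
  obtain ⟨r, hr1, hr2⟩ := ih (N - k) (by omega) (fun i => 2 * x (k + i) - 1) (by simp [hk])
    (by simp only [Nat.add_sub_cancel' hkN, hN]; norm_num)
    fun i hi => by
      obtain ⟨a, m, h1, h2⟩ := hx' (k + i) (by omega)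
      refine ⟨a - 2 ^ m, m, ?_, ?_⟩
      · rw [h1, pow_succ]; push_cast; field_simp
      · rw [← add_assoc, h2, pow_succ]; push_cast; field_simp; ring
  refine ⟨.node () l r, by simp only [BinaryTree.numLeaves]; omega, fun i hi => ?_⟩
  simp only [leafMap, hl1]
  split_ifs with h
  · have h' : i ≤ k := by exact_mod_cast h
    rw [hl2 i h']; ring
  · have h' : k < i := by exact_mod_cast not_le.1 h
    rw [← Nat.cast_sub h'.le, hr2 _ (by omega), Nat.add_sub_cancel' h'.le]; ring

/-- The real function that extends an increasing bijection of `[0,1]`. -/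
noncomputable def evalReal (f : Icc (0 : ℝ) 1 ≃o Icc (0 : ℝ) 1) (x : ℝ) : ℝ :=
  f (projIcc 0 1 zero_le_one x)

theorem evalReal_of_mem (f : Icc (0 : ℝ) 1 ≃o Icc (0 : ℝ) 1) {x : ℝ} (hx : x ∈ Icc (0 : ℝ) 1) :
    evalReal f x = f ⟨x, hx⟩ := by
  rw [evalReal, projIcc_of_mem _ hx]

theorem evalReal_coe (f : Icc (0 : ℝ) 1 ≃o Icc (0 : ℝ) 1) (x : Icc (0 : ℝ) 1) :
    evalReal f x = f x := evalReal_of_mem f x.2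

theorem evalReal_mem (f : Icc (0 : ℝ) 1 ≃o Icc (0 : ℝ) 1) (x : ℝ) :
    evalReal f x ∈ Icc (0 : ℝ) 1 := (f _).2

theorem evalReal_mul (f g : Icc (0 : ℝ) 1 ≃o Icc (0 : ℝ) 1) (x : ℝ) :
    evalReal (f * g) x = evalReal f (evalReal g x) := by
  rw [evalReal, evalReal, evalReal, projIcc_val]; rfl

theorem evalReal_one {x : ℝ} (hx : x ∈ Icc (0 : ℝ) 1) : evalReal 1 x = x := by
  rw [evalReal_of_mem _ hx]; rfl

theorem evalReal_zero (f : Icc (0 : ℝ) 1 ≃o Icc (0 : ℝ) 1) : evalReal f 0 = 0 := by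
  rw [evalReal_of_mem _ (by simp)]
  have := f.map_bot
  exact congrArg Subtype.val this

theorem evalReal_one_right (f : Icc (0 : ℝ) 1 ≃o Icc (0 : ℝ) 1) : evalReal f 1 = 1 := by
  rw [evalReal_of_mem _ (by simp)]
  have := f.map_top
  exact congrArg Subtype.val this

theorem evalReal_lt (f : Icc (0 : ℝ) 1 ≃o Icc (0 : ℝ) 1) {x y : ℝ} (hx : 0 ≤ x) (hxy : x < y)
    (hy : y ≤ 1) : evalReal f x < evalReal f y := by
  rw [evalReal_of_mem f ⟨hx, by linarith⟩, evalReal_of_mem f ⟨by linarith, hy⟩]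
  exact f.strictMono hxy

theorem evalReal_ext {f g : Icc (0 : ℝ) 1 ≃o Icc (0 : ℝ) 1}
    (h : ∀ x ∈ Icc (0 : ℝ) 1, evalReal f x = evalReal g x) : f = g := by
  ext x
  rw [← evalReal_coe, ← evalReal_coe]
  exact h x x.2

theorem TreePair.evalReal_toOrderIso (p : TreePair) {x : ℝ} (hx : x ∈ Icc (0 : ℝ) 1) :
    evalReal p.toOrderIso x = leafMap p.target (leafCoord p.source x) := by
  rw [evalReal_of_mem _ hx, TreePair.toOrderIso_apply]

/-! ### Tree pairs from uniform dyadic grids -/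

theorem IsDyadic.eventually {x : ℝ} (hx : IsDyadic x) :
    ∀ᶠ M : ℕ in atTop, ∃ z : ℤ, 2 ^ M * x = z := by
  obtain ⟨a, n, rfl⟩ := hx
  filter_upwards [eventually_ge_atTop n] with M hM
  obtain ⟨d, rfl⟩ := Nat.exists_eq_add_of_le hM
  refine ⟨a * 2 ^ d, ?_⟩
  push_cast
  rw [pow_add]
  field_simp

/-- The integrality condition says that the image of the i-th grid interval starts at (i +
z)/2^(M-n). Its length is 2^(n-M), so the image is again a standard dyadic interval. -/
theorem IsDyadicPL.exists_affine_uniform {f : Icc (0 : ℝ) 1 ≃o Icc (0 : ℝ) 1}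
    (hf : IsDyadicPL f) : ∃ M : ℕ, ∀ i : ℕ, i < 2 ^ M → ∃ (n : ℤ) (c : ℝ) (z : ℤ),
      (∀ x ∈ Icc ((i : ℝ) / 2 ^ M) ((i + 1) / 2 ^ M), evalReal f x = 2 ^ n * x + c) ∧
      2 ^ M * (2 ^ (-n) * c) = z := by
  have hf0 := hf
  obtain ⟨D, hD, haff⟩ := hf
  obtain ⟨K, hK⟩ : ∃ K : ℕ, ∀ d ∈ D, ∃ z : ℤ, 2 ^ K * (d : ℝ) = z :=
    ((eventually_all_finset D).2 fun d hd => (hD d hd).1.eventually).exists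
  have hK0 : (0 : ℝ) < 2 ^ K := by positivity
  have hpiece : ∀ j : ℕ, j < 2 ^ K → ∃ (n : ℤ) (c : ℝ), IsDyadic c ∧
      ∀ x ∈ Icc ((j : ℝ) / 2 ^ K) ((j + 1) / 2 ^ K), evalReal f x = 2 ^ n * x + c := by
    intro j hj
    have hj' : (j : ℝ) + 1 ≤ 2 ^ K := by exact_mod_cast hj
    have ha : (j : ℝ) / 2 ^ K ∈ Icc (0 : ℝ) 1 :=
      ⟨by positivity, by rw [div_le_one hK0]; linarith⟩
    have hb : ((j : ℝ) + 1) / 2 ^ K ∈ Icc (0 : ℝ) 1 :=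
      ⟨by positivity, by rw [div_le_one hK0]; linarith⟩
    obtain ⟨n, c, h⟩ := haff ⟨_, ha⟩ ⟨_, hb⟩
      (by rw [Subtype.mk_lt_mk]; gcongr; linarith) fun d hd => by
        obtain ⟨z, hz⟩ := hK d hd
        simp only [← Subtype.coe_le_coe, le_div_iff₀ hK0, div_le_iff₀ hK0, mul_comm (d : ℝ), hz]
        rcases le_or_gt z j with h | h
        · left; exact_mod_cast h
        · right; exact_mod_cast h
    have h' : ∀ x ∈ Icc ((j : ℝ) / 2 ^ K) ((j + 1) / 2 ^ K), evalReal f x = 2 ^ n * x + c := by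
      intro x hx
      rw [evalReal_of_mem f ⟨ha.1.trans hx.1, hx.2.trans hb.2⟩]
      exact h _ ⟨hx.1, hx.2⟩
    refine ⟨n, c, ?_, h'⟩
    have hdy : IsDyadic ((j : ℝ) / 2 ^ K) := ⟨j, K, by simp⟩
    have h1 := h' _ ⟨le_rfl, by gcongr; linarith⟩
    rw [evalReal_of_mem f ha] at h1
    have h2 := hf0.map_dyadic (x := ⟨_, ha⟩) hdy
    have h3 : c = (f ⟨(j : ℝ) / 2 ^ K, ha⟩ : ℝ) + -(2 ^ n * ((j : ℝ) / 2 ^ K)) := by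
      rw [h1]; ring
    rw [h3]
    exact h2.add (hdy.zpow_mul n).neg
  choose! n c hc haff' using hpiece
  -- Finitely many dyadic numbers have a common denominator; K ≤ M keeps the grid finer than the
  -- affine pieces.
  obtain ⟨M, hKM, hM⟩ : ∃ M : ℕ, K ≤ M ∧ ∀ j ∈ Finset.range (2 ^ K),
      ∃ z : ℤ, 2 ^ M * (2 ^ (-n j) * c j) = z :=
    ((eventually_ge_atTop K).and ((eventually_all_finset _).2 fun j hj =>
      ((hc j (Finset.mem_range.1 hj)).zpow_mul _).eventually)).exists
  obtain ⟨d, rfl⟩ := Nat.exists_eq_add_of_le hKM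
  refine ⟨K + d, fun i hi => ?_⟩
  -- The i-th interval of the fine grid lies in the coarse interval numbered i / 2^d.
  have hj : i / 2 ^ d < 2 ^ K := by
    rw [Nat.div_lt_iff_lt_mul (by positivity), ← pow_add]; exact hi
  obtain ⟨z, hz⟩ := hM _ (Finset.mem_range.2 hj)
  refine ⟨n (i / 2 ^ d), c (i / 2 ^ d), z, fun x hx => haff' _ hj x ⟨?_, ?_⟩, hz⟩
  · refine le_trans ?_ hx.1
    have : ((i / 2 ^ d : ℕ) : ℝ) * 2 ^ d ≤ i := by exact_mod_cast Nat.div_mul_le_self i (2 ^ d)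
    rw [pow_add, div_le_div_iff₀ hK0 (by positivity)]
    nlinarith
  · refine hx.2.trans ?_
    have : (i : ℝ) + 1 ≤ ((i / 2 ^ d : ℕ) + 1) * 2 ^ d := by
      exact_mod_cast Nat.lt_div_mul_add (a := i) (b := 2 ^ d) (by positivity) |>.trans_eq (by ring)
    rw [pow_add, div_le_div_iff₀ (by positivity) hK0]
    nlinarith

theorem affine_eq_of_eq_endpoints {f g : ℝ → ℝ} {p q p' q' a b : ℝ} (hab : a < b)
    (hf : ∀ x ∈ Icc a b, f x = p * x + q) (hg : ∀ x ∈ Icc a b, g x = p' * x + q')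
    (ha : f a = g a) (hb : f b = g b) : ∀ x ∈ Icc a b, f x = g x := by
  have hma : a ∈ Icc a b := ⟨le_rfl, hab.le⟩
  have hmb : b ∈ Icc a b := ⟨hab.le, le_rfl⟩
  rw [hf a hma, hg a hma] at ha
  rw [hf b hmb, hg b hmb] at hb
  have hp : p = p' := by
    apply mul_right_cancel₀ (sub_pos.2 hab).ne'
    linarith
  subst hp
  intro x hx
  rw [hf x hx, hg x hx]
  linarith

/-- The source tree subdivides [0,1] uniformly into 2^M pieces, and the target tree has their images
as leaf intervals. -/
theorem TreePair.toF_surjective : Function.Surjective TreePair.toF := by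
  rintro ⟨f, hf⟩
  obtain ⟨M, hM⟩ := IsDyadicPL.exists_affine_uniform hf
  have hM0 : (0 : ℝ) < 2 ^ M := by positivity
  obtain ⟨s, hs1, hs2⟩ := exists_leafMap_eq (2 ^ M) (fun i => (i : ℝ) / 2 ^ M) (by simp)
    (by simp) fun i _ => ⟨i, M, by simp, by simp⟩
  obtain ⟨t, ht1, ht2⟩ := exists_leafMap_eq (2 ^ M) (fun i => evalReal f ((i : ℝ) / 2 ^ M))
    (by simp [evalReal_zero]) (by simp [evalReal_one_right]) fun i hi => by
      obtain ⟨n, c, z, h1, h2⟩ := hM i hi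
      have hi' : (i : ℝ) + 1 ≤ 2 ^ M := by exact_mod_cast hi
      have hle : (i : ℝ) / 2 ^ M ≤ (i + 1) / 2 ^ M := by gcongr; linarith
      have ha := h1 _ ⟨le_rfl, hle⟩
      have hb := h1 _ ⟨hle, le_rfl⟩
      -- The image of an interval of length 2^(-M) has length at most 1, so M - n is a natural
      -- number.
      have hn : n ≤ M := by
        have h3 : evalReal f ((i + 1) / 2 ^ M) - evalReal f (i / 2 ^ M) ≤ 1 := by
          linarith [(evalReal_mem f ((i + 1) / 2 ^ M)).2, (evalReal_mem f (i / 2 ^ M)).1]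
        have h4 : (2 : ℝ) ^ n * (1 / 2 ^ M) ≤ 1 := by
          rw [ha, hb] at h3
          refine le_trans (le_of_eq ?_) h3
          ring
        rw [mul_one_div, div_le_one hM0, ← zpow_natCast] at h4
        exact (zpow_le_zpow_iff_right₀ (by norm_num)).1 h4
      obtain ⟨d, hd⟩ := Int.le.dest hn
      have hd' : (2 : ℝ) ^ M = 2 ^ n * 2 ^ d := by
        rw [← zpow_natCast, ← zpow_natCast, ← hd, zpow_add₀ (by norm_num)]
      have h2n : (2 : ℝ) ^ n ≠ 0 := by positivity
      have hc : c = z / 2 ^ d := by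
        rw [← h2, hd', zpow_neg]
        field_simp
      refine ⟨i + z, d, ?_, ?_⟩
      · rw [ha, hc, hd']
        push_cast
        field_simp
      · push_cast
        rw [hb, hc, hd']
        field_simp
        ring
  have hst : s.numNodes = t.numNodes := by
    have := hs1.trans ht1.symm
    rw [s.numLeaves_eq_numNodes_succ, t.numLeaves_eq_numNodes_succ] at this
    omega
  refine ⟨⟨s, t, hst⟩, Subtype.ext (evalReal_ext fun x hx => ?_)⟩
  change evalReal (TreePair.toOrderIso ⟨s, t, hst⟩) x = _
  rw [TreePair.evalReal_toOrderIso _ hx]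
  change leafMap t (leafCoord s x) = _
  set w := leafCoord s x with hw
  have hxw : leafMap s w = x := leafMap_leafCoord _ _
  have hwm : w ∈ Icc (0 : ℝ) s.numLeaves := leafCoord_mem hx
  rw [hs1] at hwm
  push_cast at hwm
  obtain ⟨i, hi, hwi⟩ : ∃ i : ℕ, i < 2 ^ M ∧ w ∈ Icc (i : ℝ) (i + 1) := by
    rcases hwm.2.eq_or_lt with h | h
    · refine ⟨2 ^ M - 1, Nat.sub_lt (by positivity) one_pos, ?_⟩
      rw [Nat.cast_sub Nat.one_le_two_pow, h]
      push_cast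
      constructor <;> linarith
    · have h1 := Nat.floor_le hwm.1
      refine ⟨⌊w⌋₊, ?_, h1, (Nat.lt_floor_add_one w).le⟩
      have : (⌊w⌋₊ : ℝ) < 2 ^ M := by linarith
      exact_mod_cast this
  obtain ⟨n, c, z, h1, -⟩ := hM i hi
  obtain ⟨a, b, hsaff⟩ := leafMap_affine s i (hs1 ▸ hi)
  obtain ⟨a', b', htaff⟩ := leafMap_affine t i (ht1 ▸ hi)
  have hsi := hs2 i hi.le
  have hsi1 := hs2 (i + 1) hi
  have hti := ht2 i hi.le
  have hti1 := ht2 (i + 1) hi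
  push_cast at hsi hsi1 hti hti1
  rw [← hxw]
  -- In the leaf coordinate both maps are affine on [i,i+1], so agreement at the two grid points
  -- suffices.
  refine affine_eq_of_eq_endpoints (f := leafMap t) (g := fun y => evalReal f (leafMap s y))
    (p := 2 ^ a') (q := b') (p' := 2 ^ n * 2 ^ a) (q' := 2 ^ n * b + c)
    (by linarith : (i : ℝ) < i + 1) htaff (fun y hy => ?_) ?_ ?_ w hwi
  · have hm := (leafMap_strictMono s).monotone
    rw [h1 _ ⟨hsi ▸ hm hy.1, hsi1 ▸ hm hy.2⟩, hsaff y hy]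
    ring
  · simp only [hti, hsi]
  · simp only [hti1, hsi1]

theorem eq_nil_of_numNodes_eq_zero {t : BinaryTree Unit} (h : t.numNodes = 0) : t = .nil := by
  cases t with
  | nil => rfl
  | node _ _ _ => simp [BinaryTree.numNodes] at h

theorem eq_caret_of_numNodes_eq_one {t : BinaryTree Unit} (h : t.numNodes = 1) :
    t = .node () .nil .nil := by
  cases t with
  | nil => simp [BinaryTree.numNodes] at h
  | node _ l r =>
    simp only [BinaryTree.numNodes] at h
    rw [eq_nil_of_numNodes_eq_zero (t := l) (by omega),
      eq_nil_of_numNodes_eq_zero (t := r) (by omega)]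

theorem ReducedTreePair.toF_surjective : Function.Surjective ReducedTreePair.toF := by
  intro g
  -- The smallest pair for the identity is the empty one, which does not count as reduced; the pair
  -- of single carets replaces it.
  by_cases hg : g = 1
  · refine ⟨⟨⟨.node () .nil .nil, .node () .nil .nil, rfl⟩, le_rfl, fun h => ?_⟩, ?_⟩
    · simp [TreePair.size, BinaryTree.numNodes] at h
    · rw [hg]
      refine Subtype.ext (evalReal_ext fun x hx => ?_)
      rw [OneMemClass.coe_one, evalReal_one hx]
      change evalReal (TreePair.toOrderIso _) x = x
      rw [TreePair.evalReal_toOrderIso _ hx]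
      exact leafMap_leafCoord _ _
  -- A representative of least size is reduced, since a common exposed caret could be cancelled.
  · obtain ⟨p, hp, hmin⟩ : ∃ p : TreePair, p.toF = g ∧ ∀ q : TreePair, q.toF = g →
        p.size ≤ q.size := by
      obtain ⟨p, hp⟩ := TreePair.toF_surjective g
      obtain ⟨q, hq, hmin⟩ := WellFounded.has_min (measure TreePair.size).wf
        {q | q.toF = g} ⟨p, hp⟩
      exact ⟨q, hq, fun q' hq' => not_lt.1 (hmin q' hq')⟩
    refine ⟨⟨p, ?_, fun _ => ?_⟩, hp⟩
    · by_contra h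
      apply hg
      rw [← hp]
      refine Subtype.ext (evalReal_ext fun x hx => ?_)
      have h1 : p.source = .nil := by
        exact eq_nil_of_numNodes_eq_zero (by simpa [TreePair.size] using h)
      have h2 : p.target = .nil := by
        exact eq_nil_of_numNodes_eq_zero (by rw [← p.numNodes_eq, h1]; rfl)
      rw [OneMemClass.coe_one, evalReal_one hx]
      change evalReal p.toOrderIso x = x
      rw [TreePair.evalReal_toOrderIso _ hx, h1, h2]
      rfl
    · rw [Finset.disjoint_left]
      intro j hjs hjt
      obtain ⟨S, T, hST⟩ := p
      dsimp only at hjs hjt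
      obtain ⟨s, hs, rfl⟩ := exists_expandLeaf_eq hjs
      obtain ⟨t, ht, rfl⟩ := exists_expandLeaf_eq hjt
      have hst := hST
      rw [numNodes_expandLeaf, numNodes_expandLeaf] at hst
      have hst' : s.numNodes = t.numNodes := by omega
      have := hmin ⟨s, t, hst'⟩ (by
        rw [← hp]
        refine Subtype.ext (evalReal_ext fun x hx => ?_)
        change evalReal (TreePair.toOrderIso _) x = evalReal (TreePair.toOrderIso _) x
        rw [TreePair.evalReal_toOrderIso _ hx, TreePair.evalReal_toOrderIso _ hx]
        refine (leafMap_leafCoord_expandLeaf ?_ hs hx).symm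
        rw [s.numLeaves_eq_numNodes_succ, t.numLeaves_eq_numNodes_succ, hst'])
      simp only [TreePair.size, numNodes_expandLeaf] at this
      omega

/-! ### Nontrivial homomorphisms to the integers -/

/-- `f` agrees with an affine map of slope `2 ^ n` that fixes `c` on an interval with left
end point `c`. -/
def HasRightExponent (c : ℝ) (f : Icc (0 : ℝ) 1 ≃o Icc (0 : ℝ) 1) (n : ℤ) : Prop :=
  ∀ᶠ x in 𝓝[>] c, evalReal f x = c + 2 ^ n * (x - c)

theorem HasRightExponent.unique {c : ℝ} {f : Icc (0 : ℝ) 1 ≃o Icc (0 : ℝ) 1} {n m : ℤ}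
    (hn : HasRightExponent c f n) (hm : HasRightExponent c f m) : n = m := by
  obtain ⟨x, h1, h2, hx⟩ := (hn.and (hm.and self_mem_nhdsWithin)).exists
  rw [h1] at h2
  have hx' : x - c ≠ 0 := (sub_pos.2 hx).ne'
  exact zpow_right_injective₀ (by norm_num : (0 : ℝ) < 2) (by norm_num)
    (mul_right_cancel₀ hx' (add_left_cancel h2))

theorem HasRightExponent.mul {c : ℝ} {f g : Icc (0 : ℝ) 1 ≃o Icc (0 : ℝ) 1} {n m : ℤ}
    (hf : HasRightExponent c f n) (hg : HasRightExponent c g m) :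
    HasRightExponent c (f * g) (n + m) := by
  have ht : Tendsto (fun x : ℝ => c + 2 ^ m * (x - c)) (𝓝[>] c) (𝓝[>] c) := by
    refine tendsto_nhdsWithin_iff.2 ⟨?_, ?_⟩
    · have : Tendsto (fun x : ℝ => c + 2 ^ m * (x - c)) (𝓝 c) (𝓝 (c + 2 ^ m * (c - c))) :=
        (by fun_prop : Continuous fun x : ℝ => c + 2 ^ m * (x - c)).tendsto c
      rw [sub_self, mul_zero, add_zero] at this
      exact this.mono_left nhdsWithin_le_nhds
    · filter_upwards [self_mem_nhdsWithin] with x hx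
      have : 0 < (2 : ℝ) ^ m * (x - c) := mul_pos (by positivity) (sub_pos.2 hx)
      exact mem_Ioi.2 (by linarith)
  filter_upwards [hg, ht.eventually hf] with x h1 h2
  rw [evalReal_mul, h1, h2, zpow_add₀ (by norm_num)]
  ring

theorem IsDyadicPL.exists_hasRightExponent {f : Icc (0 : ℝ) 1 ≃o Icc (0 : ℝ) 1}
    (hf : IsDyadicPL f) {c : ℝ} (h0 : 0 ≤ c) (h1 : c < 1) (hc : evalReal f c = c) :
    ∃ n, HasRightExponent c f n := by
  obtain ⟨D, -, haff⟩ := hf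
  have h2 : ∀ᶠ b : ℝ in 𝓝[>] c, ∀ d ∈ D, (d : ℝ) ≤ c ∨ b ≤ (d : ℝ) := by
    refine (eventually_all_finset D).2 fun d _ => ?_
    rcases le_or_gt (d : ℝ) c with h | h
    · exact Eventually.of_forall fun _ => Or.inl h
    · filter_upwards [Ioo_mem_nhdsGT h] with b hb using Or.inr hb.2.le
  obtain ⟨b, hb, hcb, hb1⟩ := (h2.and (Ioo_mem_nhdsGT h1)).exists
  obtain ⟨n, e, h⟩ := haff ⟨c, h0, h1.le⟩ ⟨b, by linarith, hb1.le⟩ hcb fun d hd => hb d hd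
  refine ⟨n, ?_⟩
  have h3 := h ⟨c, h0, h1.le⟩ ⟨le_rfl, hcb.le⟩
  rw [← evalReal_of_mem f ⟨h0, h1.le⟩, hc] at h3
  filter_upwards [Ioo_mem_nhdsGT hcb] with x hx
  have hx' : x ∈ Icc (0 : ℝ) 1 := ⟨by linarith [hx.1], by linarith [hx.2]⟩
  rw [evalReal_of_mem _ hx', h ⟨x, hx'⟩ ⟨hx.1.le, hx.2.le⟩]
  simp only at h3 ⊢
  linarith

theorem continuous_evalReal (f : Icc (0 : ℝ) 1 ≃o Icc (0 : ℝ) 1) : Continuous (evalReal f) :=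
  continuous_subtype_val.comp (f.continuous.comp continuous_projIcc)

/-- Take c to be the supremum of the x such that every h i fixes [0,x] pointwise. It is less than 1
because some h i is nontrivial, and the segment cannot be prolonged. -/
theorem exists_maximal_common_fixed_segment {ι : Type*} [Finite ι]
    (h : ι → Icc (0 : ℝ) 1 ≃o Icc (0 : ℝ) 1) (hne : ∃ i, h i ≠ 1) :
    ∃ c : ℝ, 0 ≤ c ∧ c < 1 ∧ (∀ i, evalReal (h i) c = c) ∧
      ¬ ∀ i, ∀ᶠ x in 𝓝[>] c, evalReal (h i) x = x := by
  set S : Set ℝ := {x | x ∈ Icc (0 : ℝ) 1 ∧ ∀ i, ∀ y ∈ Icc 0 x, evalReal (h i) y = y} with hS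
  have h0S : (0 : ℝ) ∈ S := ⟨by simp, fun i y hy => by
    rw [le_antisymm hy.2 hy.1, evalReal_zero]⟩
  have hbdd : BddAbove S := ⟨1, fun x hx => hx.1.2⟩
  set c := sSup S with hcdef
  have hc0 : 0 ≤ c := le_csSup hbdd h0S
  have hc1 : c ≤ 1 := csSup_le ⟨0, h0S⟩ fun x hx => hx.1.2
  have hIco : ∀ i, Ico 0 c ⊆ {y | evalReal (h i) y = y} := fun i y hy => by
    obtain ⟨x, hx, hyx⟩ := exists_lt_of_lt_csSup ⟨0, h0S⟩ hy.2
    exact hx.2 i y ⟨hy.1, hyx.le⟩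
  have hIcc : ∀ i, ∀ y ∈ Icc 0 c, evalReal (h i) y = y := fun i y hy => by
    rcases hc0.eq_or_lt with h0 | h0
    · rw [← h0] at hy
      rw [le_antisymm hy.2 hy.1, evalReal_zero]
    · have := (isClosed_eq (continuous_evalReal (h i)) continuous_id).closure_subset_iff.2 (hIco i)
      rw [closure_Ico h0.ne] at this
      exact this hy
  refine ⟨c, hc0, lt_of_le_of_ne hc1 ?_, fun i => hIcc i c ⟨hc0, le_rfl⟩, ?_⟩
  · intro h1
    obtain ⟨i, hi⟩ := hne
    refine hi (evalReal_ext fun x hx => ?_)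
    rw [evalReal_one hx]
    exact hIcc i x (h1 ▸ hx)
  · intro hall
    rcases hc1.eq_or_lt with h1 | h1
    · obtain ⟨i, hi⟩ := hne
      refine hi (evalReal_ext fun x hx => ?_)
      rw [evalReal_one hx]
      exact hIcc i x (h1 ▸ hx)
    · have h2 := eventually_all.2 hall
      obtain ⟨u, hu, hsub⟩ := mem_nhdsGT_iff_exists_Ioo_subset.1
        (h2.and (Ioo_mem_nhdsGT h1))
      have hm : (c + u) / 2 ∈ Ioo c u := ⟨by linarith [mem_Ioi.1 hu], by linarith [mem_Ioi.1 hu]⟩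
      have : (c + u) / 2 ∈ S := by
        refine ⟨⟨by linarith [hm.1], (hsub hm).2.2.le⟩, fun i y hy => ?_⟩
        rcases le_or_gt y c with hyc | hyc
        · exact hIcc i y ⟨hy.1, hyc⟩
        · exact (hsub ⟨hyc, by linarith [hy.2, hm.2]⟩).1 i
      linarith [le_csSup hbdd this, hm.1]

/-- Finitely generated subgroups of `F` are indicable. -/
theorem exists_hom_int_ne_one {ι : Type*} [Finite ι] (h : ι → ThompsonF) (H : Subgroup ThompsonF)
    (hgen : H = Subgroup.closure (range h)) (hne : H ≠ ⊥) :
    ∃ χ : H →* Multiplicative ℤ, χ ≠ 1 := by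
  have hne' : ∃ i, (h i : Icc (0 : ℝ) 1 ≃o Icc (0 : ℝ) 1) ≠ 1 := by
    by_contra! hall
    apply hne
    rw [hgen, Subgroup.closure_eq_bot_iff]
    rintro _ ⟨i, rfl⟩
    exact Subtype.ext (hall i)
  obtain ⟨c, hc0, hc1, hfix, hnot⟩ := exists_maximal_common_fixed_segment (fun i => (h i).1) hne'
  have hfixH : ∀ f ∈ H, evalReal (f : Icc (0 : ℝ) 1 ≃o Icc (0 : ℝ) 1) c = c := by
    intro f hf
    rw [hgen] at hf
    induction hf using Subgroup.closure_induction with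
    | mem f hf =>
      obtain ⟨i, rfl⟩ := hf
      exact hfix i
    | one => exact evalReal_one ⟨hc0, hc1.le⟩
    | mul f g _ _ hf hg => rw [Subgroup.coe_mul, evalReal_mul, hg, hf]
    | inv f _ hf =>
      have := evalReal_mul (f : Icc (0 : ℝ) 1 ≃o Icc (0 : ℝ) 1)⁻¹ f c
      rw [hf, inv_mul_cancel, evalReal_one ⟨hc0, hc1.le⟩] at this
      exact this.symm
  have hex : ∀ f : H, ∃ n, HasRightExponent c f.1.1 n := fun f =>
    f.1.2.exists_hasRightExponent hc0 hc1 (hfixH f.1 f.2)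
  choose e he using hex
  -- The exponent of the slope to the right of the common fixed point c is additive by the chain
  -- rule. If it vanished on H, all generators would be the identity just to the right of c.
  let χ : H →* Multiplicative ℤ := MonoidHom.mk' (fun f => Multiplicative.ofAdd (e f))
    fun f g => by
      rw [← ofAdd_add]
      exact congrArg _ ((he (f * g)).unique ((he f).mul (he g)))
  refine ⟨χ, fun hχ => hnot fun i => ?_⟩
  have hi : h i ∈ H := hgen ▸ Subgroup.subset_closure ⟨i, rfl⟩
  have h1 : e ⟨h i, hi⟩ = 0 := by
    have : χ ⟨h i, hi⟩ = 1 := by rw [hχ]; rfl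
    exact Multiplicative.ofAdd.injective this
  have h2 := he ⟨h i, hi⟩
  rw [h1] at h2
  filter_upwards [h2] with x hx
  rw [hx]
  simp

/-! ### Nielsen moves on generating families -/

theorem closure_range_update_mul {ι G : Type*} [Group G] [DecidableEq ι] (g : ι → G) {i j : ι}
    (hij : i ≠ j) (e : ℤ) :
    Subgroup.closure (range (Function.update g j (g j * g i ^ e))) =
      Subgroup.closure (range g) := by
  set g' := Function.update g j (g j * g i ^ e) with hg'
  have hi : g' i = g i := Function.update_of_ne hij _ _
  have hj : g' j = g j * g i ^ e := Function.update_self _ _ _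
  apply le_antisymm <;> rw [Subgroup.closure_le] <;> rintro _ ⟨l, rfl⟩ <;> by_cases hl : l = j
  · rw [hl, hj]
    exact mul_mem (Subgroup.subset_closure ⟨j, rfl⟩)
      (zpow_mem (Subgroup.subset_closure (mem_range_self i)) _)
  · rw [hg', Function.update_of_ne hl]
    exact Subgroup.subset_closure ⟨l, rfl⟩
  · have : g l = g' j * (g' i ^ e)⁻¹ := by rw [hi, hj, hl]; group
    rw [this]
    exact mul_mem (Subgroup.subset_closure ⟨j, rfl⟩)
      (inv_mem (zpow_mem (Subgroup.subset_closure (mem_range_self i)) _))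
  · rw [← show g' l = g l from Function.update_of_ne hl _ _]
    exact Subgroup.subset_closure ⟨l, rfl⟩

/-- By the Euclidean algorithm, a finite generating family can be changed so that a
given homomorphism to `ℤ` is nontrivial on one generator only. -/
theorem exists_generators_hom_trivial_off {ι G : Type*} [Group G] [Fintype ι] [DecidableEq ι]
    (χ : G →* Multiplicative ℤ) (hχ : χ ≠ 1) (g : ι → G)
    (hg : Subgroup.closure (range g) = ⊤) :
    ∃ (g' : ι → G) (i : ι), Subgroup.closure (range g') = ⊤ ∧ χ (g' i) ≠ 1 ∧
      ∀ j ≠ i, χ (g' j) = 1 := by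
  induction hN : ∑ i, (χ (g i)).toAdd.natAbs using Nat.strong_induction_on generalizing g with
  | _ N ih =>
  obtain ⟨i, hi⟩ : ∃ i, χ (g i) ≠ 1 := by
    by_contra! h
    apply hχ
    refine MonoidHom.eq_of_eqOn_dense hg ?_
    rintro _ ⟨i, rfl⟩
    exact h i
  by_cases hall : ∀ j ≠ i, χ (g j) = 1
  · exact ⟨g, i, hg, hi, hall⟩
  push Not at hall
  obtain ⟨j, hji, hj⟩ := hall
  obtain ⟨i, j, hij, hi, hj, hle⟩ : ∃ i j, i ≠ j ∧ χ (g i) ≠ 1 ∧ χ (g j) ≠ 1 ∧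
      (χ (g i)).toAdd.natAbs ≤ (χ (g j)).toAdd.natAbs := by
    rcases le_total (χ (g i)).toAdd.natAbs (χ (g j)).toAdd.natAbs with h | h
    · exact ⟨i, j, hji.symm, hi, hj, h⟩
    · exact ⟨j, i, hji, hj, hi, h⟩
  have hi' : (χ (g i)).toAdd ≠ 0 := fun h => hi (Multiplicative.toAdd.injective h)
  -- Subtract when the signs agree, add when they differ; the larger absolute value drops since the
  -- smaller one is not zero.
  obtain ⟨e, he⟩ : ∃ e : ℤ, ((χ (g j)).toAdd + e * (χ (g i)).toAdd).natAbs <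
      (χ (g j)).toAdd.natAbs := by
    by_cases hs : (0 < (χ (g j)).toAdd ↔ 0 < (χ (g i)).toAdd)
    · exact ⟨-1, by omega⟩
    · exact ⟨1, by omega⟩
  refine ih _ ?_ (Function.update g j (g j * g i ^ e))
    ((closure_range_update_mul g hij e).trans hg) rfl
  rw [← hN]
  refine Finset.sum_lt_sum (fun l _ => ?_) ⟨j, Finset.mem_univ _, ?_⟩
  · by_cases hl : l = j
    · subst hl
      simpa [Function.update_self] using he.le
    · rw [Function.update_of_ne hl]
  · simpa [Function.update_self] using he

/-! ### Elements that act separately on the two halves of `[0,1]` -/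

/-- The tree pair obtained by placing `p` under the left and `q` under the right leaf of a
caret. -/
def TreePair.join (p q : TreePair) : TreePair where
  source := .node () p.source q.source
  target := .node () p.target q.target
  numNodes_eq := by simp [BinaryTree.numNodes, p.numNodes_eq, q.numNodes_eq]

theorem TreePair.size_join (p q : TreePair) : (p.join q).size = p.size + q.size + 1 := rfl

theorem TreePair.join_right_injective (p : TreePair) : Function.Injective p.join := by
  rintro ⟨s, t, h⟩ ⟨s', t', h'⟩ he
  obtain ⟨h1, h2⟩ := TreePair.mk.inj he
  obtain ⟨-, -, rfl⟩ := BinaryTree.node.inj h1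
  obtain ⟨-, -, rfl⟩ := BinaryTree.node.inj h2
  rfl

theorem TreePair.evalReal_join (p q : TreePair) {x : ℝ} (hx : x ∈ Icc (0 : ℝ) 1) :
    evalReal (p.join q).toOrderIso x =
      if x ≤ 1 / 2 then evalReal p.toOrderIso (2 * x) / 2
      else (1 + evalReal q.toOrderIso (2 * x - 1)) / 2 := by
  rw [TreePair.evalReal_toOrderIso _ hx]
  simp only [TreePair.join, leafCoord]
  split_ifs with h
  · have hx2 : 2 * x ∈ Icc (0 : ℝ) 1 := ⟨by linarith [hx.1], by linarith⟩
    have h1 := (leafCoord_mem (t := p.source) hx2).2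
    rw [p.numLeaves_eq] at h1
    simp only [leafMap, if_pos h1, TreePair.evalReal_toOrderIso _ hx2]
  · rw [not_le] at h
    have hx2 : 2 * x - 1 ∈ Icc (0 : ℝ) 1 := ⟨by linarith, by linarith [hx.2]⟩
    have h1 : 0 < leafCoord q.source (2 * x - 1) := by
      rw [← (leafMap_strictMono q.source).lt_iff_lt, leafMap_leafCoord, leafMap_zero]
      linarith
    have h2 : ¬ ((p.target.numLeaves : ℝ) + leafCoord q.source (2 * x - 1) ≤
        p.target.numLeaves) := by linarith
    simp only [leafMap, p.numLeaves_eq, if_neg h2, add_sub_cancel_left,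
      TreePair.evalReal_toOrderIso _ hx2]

/-- The element of `F` that acts as `f` on the left half and as `g` on the right half of
`[0,1]`. -/
noncomputable def joinF (f g : ThompsonF) : ThompsonF :=
  ((Function.surjInv TreePair.toF_surjective f).join
    (Function.surjInv TreePair.toF_surjective g)).toF

/-- Shows that `joinF` does not depend on the chosen tree pairs. -/
theorem evalReal_joinF (f g : ThompsonF) {x : ℝ} (hx : x ∈ Icc (0 : ℝ) 1) :
    evalReal (joinF f g).1 x =
      if x ≤ 1 / 2 then evalReal f.1 (2 * x) / 2 else (1 + evalReal g.1 (2 * x - 1)) / 2 := by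
  have h := TreePair.evalReal_join (Function.surjInv TreePair.toF_surjective f)
    (Function.surjInv TreePair.toF_surjective g) hx
  have hf := congrArg Subtype.val (Function.surjInv_eq TreePair.toF_surjective f)
  have hg := congrArg Subtype.val (Function.surjInv_eq TreePair.toF_surjective g)
  simp only [TreePair.toF] at hf hg
  rw [hf, hg] at h
  exact h

theorem TreePair.toF_join (p q : TreePair) : (p.join q).toF = joinF p.toF q.toF :=
  Subtype.ext (evalReal_ext fun _ hx =>
    (TreePair.evalReal_join p q hx).trans (evalReal_joinF p.toF q.toF hx).symm)

theorem joinF_mul (f f' g g' : ThompsonF) :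
    joinF (f * f') (g * g') = joinF f g * joinF f' g' := by
  refine Subtype.ext (evalReal_ext fun x hx => ?_)
  rw [Subgroup.coe_mul, evalReal_mul, evalReal_joinF _ _ hx, evalReal_joinF _ _ (evalReal_mem _ _),
    evalReal_joinF _ _ hx, Subgroup.coe_mul, Subgroup.coe_mul, evalReal_mul, evalReal_mul]
  -- The inner map preserves both halves, so the two mixed cases are contradictory.
  split_ifs with h1 h2 h2
  · congr 2; ring
  · have := (evalReal_mem f'.1 (2 * x)).2
    linarith
  · have := evalReal_lt g'.1 le_rfl (show 0 < 2 * x - 1 by linarith) (by linarith [hx.2])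
    rw [evalReal_zero] at this
    linarith
  · congr 3; ring

/-- `F × F` acts on the two halves of `[0,1]`. -/
noncomputable def joinHom : ThompsonF × ThompsonF →* ThompsonF :=
  MonoidHom.mk' (fun p => joinF p.1 p.2) fun p q => joinF_mul p.1 q.1 p.2 q.2

theorem eq_of_joinF_eq {f f' g g' : ThompsonF} (h : joinF f g = joinF f' g') : f = f' := by
  refine Subtype.ext (evalReal_ext fun x hx => ?_)
  have hx' : x / 2 ∈ Icc (0 : ℝ) 1 := ⟨by linarith [hx.1], by linarith [hx.2]⟩
  have h1 := evalReal_joinF f g hx'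
  rw [h, evalReal_joinF _ _ hx', if_pos (by linarith [hx.2]), if_pos (by linarith [hx.2]),
    mul_div_cancel₀ _ two_ne_zero] at h1
  linarith

/-- The other generators lie in the kernel, so every value of χ is a multiple of d = χ (g i), and χ
can be divided by d. -/
theorem exists_hom_eq_one_of_ne_one {ι G : Type*} [Group G] (χ : G →* Multiplicative ℤ)
    (g : ι → G) (hg : Subgroup.closure (range g) = ⊤) (i : ι) (hi : χ (g i) ≠ 1)
    (hj : ∀ j ≠ i, χ (g j) = 1) :
    ∃ ψ : G →* Multiplicative ℤ, ψ (g i) = Multiplicative.ofAdd 1 ∧ ∀ j ≠ i, ψ (g j) = 1 := by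
  set d := (χ (g i)).toAdd with hd
  have hd0 : d ≠ 0 := fun h => hi (Multiplicative.toAdd.injective h)
  have hdvd : ∀ x, d ∣ (χ x).toAdd := by
    have h1 : Subgroup.closure (range g) ≤ (Subgroup.zpowers (χ (g i))).comap χ := by
      rw [Subgroup.closure_le]
      rintro _ ⟨j, rfl⟩
      by_cases hji : j = i
      · rw [hji]; exact Subgroup.mem_zpowers _
      · rw [SetLike.mem_coe, Subgroup.mem_comap, hj j hji]; exact one_mem _
    intro x
    obtain ⟨n, hn⟩ := h1 (hg ▸ Subgroup.mem_top x : x ∈ Subgroup.closure (range g))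
    refine ⟨n, ?_⟩
    rw [← hn]
    simp [hd, mul_comm]
  refine ⟨MonoidHom.mk' (fun x => Multiplicative.ofAdd ((χ x).toAdd / d)) fun x y => ?_, ?_, ?_⟩
  · rw [← ofAdd_add, map_mul, toAdd_mul, Int.add_ediv_of_dvd_left (hdvd x)]
  · simp [← hd, Int.ediv_self hd0]
  · intro j hji
    simp [hj j hji]

/-- If `ψ` is a homomorphism to `ℤ` that is `1` on one generator and `0` on
the others, then that generator can be changed on the right half at will. -/
theorem nonempty_closure_range_joinF_mulEquiv {ι : Type*} [DecidableEq ι] {H : Subgroup ThompsonF}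
    (g : ι → H)
    (hg : Subgroup.closure (range g) = ⊤) (ψ : H →* Multiplicative ℤ) (i : ι)
    (hi : ψ (g i) = Multiplicative.ofAdd 1) (hj : ∀ j ≠ i, ψ (g j) = 1) (f : ThompsonF) :
    Nonempty (Subgroup.closure (range fun j => joinF (g j) (if j = i then f else 1)) ≃* H) := by
  -- Φ sends x to the pair (x, f^ψ(x)): the left half makes it injective, and on the generators it
  -- gives exactly the listed elements.
  set Φ : H →* ThompsonF := joinHom.comp (H.subtype.prod ((zpowersHom ThompsonF f).comp ψ)) with hΦ
  have hΦ' : ∀ x, Φ x = joinF x (f ^ (ψ x).toAdd) := fun x => rfl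
  have hinj : Function.Injective Φ := fun x y hxy => by
    rw [hΦ', hΦ'] at hxy
    exact Subtype.ext (eq_of_joinF_eq hxy)
  have hrange : Φ.range = Subgroup.closure
      (range fun j => joinF (g j) (if j = i then f else 1)) := by
    rw [MonoidHom.range_eq_map, ← hg, MonoidHom.map_closure, ← range_comp]
    congr 2
    funext j
    rw [Function.comp_apply, hΦ']
    split_ifs with h
    · rw [h, hi]; simp
    · rw [hj j h]; simp
  rw [← hrange]
  exact ⟨(MonoidHom.ofInjective hinj).symm⟩

/-! ### Reducedness of joined pairs -/

theorem disjoint_exposedCarets_node {l r l' r' : BinaryTree Unit} (hl : l.numNodes = l'.numNodes)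
    (h : l.numNodes ≠ 0 ∨ r.numNodes ≠ 0) (h' : l'.numNodes ≠ 0 ∨ r'.numNodes ≠ 0)
    (hdl : Disjoint (exposedCarets l) (exposedCarets l'))
    (hdr : Disjoint (exposedCarets r) (exposedCarets r')) :
    Disjoint (exposedCarets (.node () l r)) (exposedCarets (.node () l' r')) := by
  have hnil : ∀ {l r : BinaryTree Unit} {i : ℕ}, (l.numNodes ≠ 0 ∨ r.numNodes ≠ 0) →
      ¬ (l = .nil ∧ r = .nil ∧ i = 0) := by
    rintro l r i h ⟨rfl, rfl, -⟩
    simp [BinaryTree.numNodes] at h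
  have hl' : l.numLeaves = l'.numLeaves := by
    rw [l.numLeaves_eq_numNodes_succ, l'.numLeaves_eq_numNodes_succ, hl]
  rw [Finset.disjoint_left] at *
  intro i h1 h2
  rw [mem_exposedCarets_node] at h1 h2
  simp only [hnil h, hnil h', false_or] at h1 h2
  rcases h1 with h1 | ⟨h1, h1'⟩ <;> rcases h2 with h2 | ⟨h2, h2'⟩
  · exact hdl h1 h2
  · have := succ_lt_numLeaves_of_mem_exposedCarets h1
    omega
  · have := succ_lt_numLeaves_of_mem_exposedCarets h2
    omega
  · rw [hl'] at h1'
    exact hdr h1' h2'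

/-- Sizes of at least 2 are required because the pair of single carets counts as reduced although
its exposed caret is common. -/
theorem TreePair.IsReduced.join {p q : TreePair} (hp : p.IsReduced) (hq : q.IsReduced)
    (hp2 : 2 ≤ p.size) (hq2 : 2 ≤ q.size) : (p.join q).IsReduced := by
  refine ⟨by rw [TreePair.size_join]; omega, fun _ => ?_⟩
  have h1 : p.source.numNodes ≠ 0 := by have := hp.1; rw [TreePair.size] at this; omega
  exact disjoint_exposedCarets_node p.numNodes_eq (Or.inl h1) (Or.inl (p.numNodes_eq ▸ h1))
    (hp.2 hp2) (hq.2 hq2)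

theorem ReducedTreePair.two_le_size_of_toF_ne_one (t : ReducedTreePair) (ht : t.toF ≠ 1) :
    2 ≤ t.size := by
  obtain ⟨⟨s, s', hs⟩, hr⟩ := t
  by_contra h
  have h1 : s.numNodes = 1 := by
    have h1 := hr.1
    simp only [TreePair.size] at h1
    simp only [ReducedTreePair.size, TreePair.size] at h
    omega
  apply ht
  refine Subtype.ext (evalReal_ext fun x hx => ?_)
  rw [OneMemClass.coe_one, evalReal_one hx]
  change evalReal (TreePair.toOrderIso _) x = x
  rw [TreePair.evalReal_toOrderIso _ hx]
  change leafMap s' (leafCoord s x) = x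
  rw [eq_caret_of_numNodes_eq_one h1,
    eq_caret_of_numNodes_eq_one (t := s') (hs ▸ h1), leafMap_leafCoord]

/-! ### Counting reduced tree pairs and tuples of them -/

/-- Two pairs are hung below a common root caret, which can be undone; n ≥ 1 ensures that the root
itself is not exposed. -/
theorem sum_card_disjointPairs_mul_le {n : ℕ} (hn : 1 ≤ n) :
    ∑ p ∈ Finset.HasAntidiagonal.antidiagonal n,
        (disjointPairs p.1).card * (disjointPairs p.2).card ≤
      (disjointPairs (n + 1)).card := by
  simp only [← Finset.card_product]
  rw [← Finset.card_sigma]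
  refine Finset.card_le_card_of_injOn
    (fun x => (.node () x.2.1.1 x.2.2.1, .node () x.2.1.2 x.2.2.2)) ?_ ?_
  · rintro ⟨⟨i, j⟩, ⟨s, t⟩, ⟨s', t'⟩⟩ hx
    simp only [Finset.coe_sigma, Set.mem_sigma_iff, Finset.mem_coe,
      Finset.HasAntidiagonal.mem_antidiagonal, Finset.mem_product, mem_disjointPairs] at hx
    obtain ⟨hij, ⟨hs, ht, hd⟩, hs', ht', hd'⟩ := hx
    rw [Finset.mem_coe, mem_disjointPairs]
    refine ⟨by simp only [BinaryTree.numNodes]; omega, by simp only [BinaryTree.numNodes]; omega,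
      disjoint_exposedCarets_node (l := s) (r := s') (l' := t) (r' := t') (hs.trans ht.symm)
        (by omega) (by omega) hd hd'⟩
  · rintro ⟨⟨i, j⟩, ⟨s, t⟩, ⟨s', t'⟩⟩ hx ⟨⟨i', j'⟩, ⟨s₁, t₁⟩, ⟨s₁', t₁'⟩⟩ hy he
    simp only [Finset.coe_sigma, Set.mem_sigma_iff, Finset.mem_coe,
      Finset.HasAntidiagonal.mem_antidiagonal, Finset.mem_product, mem_disjointPairs] at hx hy
    simp only [Prod.mk.injEq, BinaryTree.node.injEq, true_and] at he
    obtain ⟨⟨rfl, rfl⟩, rfl, rfl⟩ := he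
    obtain ⟨-, ⟨rfl, -, -⟩, rfl, -, -⟩ := hx
    obtain ⟨-, ⟨rfl, -, -⟩, rfl, -, -⟩ := hy
    rfl

theorem card_disjointPairs_zero : (disjointPairs 0).card = 1 := by
  rw [Finset.card_eq_one]
  refine ⟨(.nil, .nil), ?_⟩
  ext ⟨s, t⟩
  rw [mem_disjointPairs, Finset.mem_singleton, Prod.mk.injEq]
  constructor
  · rintro ⟨h1, h2, -⟩
    exact ⟨eq_nil_of_numNodes_eq_zero h1, eq_nil_of_numNodes_eq_zero h2⟩
  · rintro ⟨rfl, rfl⟩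
    simp [BinaryTree.numNodes, exposedCarets]

theorem card_disjointPairs_le_succ {n : ℕ} (hn : 1 ≤ n) :
    (disjointPairs n).card ≤ (disjointPairs (n + 1)).card := by
  refine le_trans ?_ (sum_card_disjointPairs_mul_le hn)
  have := Finset.single_le_sum (f := fun p : ℕ × ℕ =>
    (disjointPairs p.1).card * (disjointPairs p.2).card)
    (s := Finset.HasAntidiagonal.antidiagonal n)
    (fun _ _ => Nat.zero_le _) (a := (n, 0)) (by simp)
  simpa [card_disjointPairs_zero] using this

theorem one_le_card_disjointPairs_two : 1 ≤ (disjointPairs 2).card := by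
  refine Finset.card_pos.2 ⟨(.node () (.node () .nil .nil) .nil,
    .node () .nil (.node () .nil .nil)), mem_disjointPairs.2 ⟨rfl, rfl, ?_⟩⟩
  simp [exposedCarets, BinaryTree.numLeaves]

/-- The set of reduced tree pairs of size `n`. -/
def reducedOfSize (n : ℕ) : Set ReducedTreePair := {t | t.size = n}

theorem reducedOfSize_zero : reducedOfSize 0 = ∅ := by
  refine eq_empty_of_forall_notMem fun t ht => ?_
  have h1 : t.1.size = 0 := ht
  have h2 := t.2.1
  omega

/-- The pair of trees of a reduced tree pair. -/
def ReducedTreePair.trees (t : ReducedTreePair) : BinaryTree Unit × BinaryTree Unit :=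
  (t.1.source, t.1.target)

theorem ReducedTreePair.trees_injective : Function.Injective ReducedTreePair.trees := by
  rintro ⟨⟨a, b, h⟩, _⟩ ⟨⟨a', b', h'⟩, _⟩ he
  simp only [ReducedTreePair.trees, Prod.mk.injEq] at he
  obtain ⟨rfl, rfl⟩ := he
  rfl

theorem image_trees_reducedOfSize_one :
    ReducedTreePair.trees '' reducedOfSize 1 = {(.node () .nil .nil, .node () .nil .nil)} := by
  ext ⟨s, t⟩
  simp only [mem_image, mem_singleton_iff, Prod.mk.injEq]
  constructor
  · rintro ⟨⟨⟨a, b, h⟩, hr⟩, hs, he⟩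
    simp only [ReducedTreePair.trees, Prod.mk.injEq] at he
    obtain ⟨rfl, rfl⟩ := he
    exact ⟨eq_caret_of_numNodes_eq_one hs, eq_caret_of_numNodes_eq_one (h ▸ hs)⟩
  · rintro ⟨rfl, rfl⟩
    refine ⟨⟨⟨.node () .nil .nil, .node () .nil .nil, rfl⟩, le_rfl, fun h => ?_⟩, rfl, rfl⟩
    simp [TreePair.size, BinaryTree.numNodes] at h

theorem image_trees_reducedOfSize {n : ℕ} (hn : 2 ≤ n) :
    ReducedTreePair.trees '' reducedOfSize n = disjointPairs n := by
  ext ⟨s, t⟩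
  simp only [mem_image, Finset.mem_coe, mem_disjointPairs]
  constructor
  · rintro ⟨⟨⟨a, b, h⟩, hr⟩, hs, he⟩
    simp only [ReducedTreePair.trees, Prod.mk.injEq] at he
    obtain ⟨rfl, rfl⟩ := he
    have hs' : a.numNodes = n := hs
    exact ⟨hs', h ▸ hs', hr.2 (hn.trans_eq hs'.symm)⟩
  · rintro ⟨h1, h2, hd⟩
    exact ⟨⟨⟨s, t, h1.trans h2.symm⟩, le_trans (by omega) (hn.trans_eq h1.symm), fun _ => hd⟩,
      h1, rfl⟩

theorem reducedOfSize_finite (n : ℕ) : (reducedOfSize n).Finite := by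
  rcases Nat.lt_or_ge n 2 with h | h
  · interval_cases n
    · rw [reducedOfSize_zero]; exact finite_empty
    · refine Set.Finite.of_finite_image ?_ ReducedTreePair.trees_injective.injOn
      rw [image_trees_reducedOfSize_one]; exact finite_singleton _
  · refine Set.Finite.of_finite_image ?_ ReducedTreePair.trees_injective.injOn
    rw [image_trees_reducedOfSize h]; exact Finset.finite_toSet _

/-- The number of reduced tree pairs of size `n`. -/
noncomputable def numReduced (n : ℕ) : ℕ := (reducedOfSize n).ncard

theorem numReduced_zero : numReduced 0 = 0 := by rw [numReduced, reducedOfSize_zero, ncard_empty]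

theorem numReduced_one : numReduced 1 = 1 := by
  rw [numReduced, ← ncard_image_of_injective _ ReducedTreePair.trees_injective,
    image_trees_reducedOfSize_one, ncard_singleton]

/-- Below 2 the counts differ: the empty pair has no common exposed caret but is not reduced, and
for single carets it is the reverse. -/
theorem numReduced_eq {n : ℕ} (hn : 2 ≤ n) : numReduced n = (disjointPairs n).card := by
  rw [numReduced, ← ncard_image_of_injective _ ReducedTreePair.trees_injective,
    image_trees_reducedOfSize hn, ncard_coe_finset]

theorem numReduced_monotone : Monotone numReduced := by
  refine monotone_nat_of_le_succ fun n => ?_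
  rcases n with _ | _ | n
  · rw [numReduced_zero]; exact Nat.zero_le _
  · rw [zero_add, numReduced_one, numReduced_eq le_rfl]
    exact one_le_card_disjointPairs_two
  · rw [numReduced_eq (by omega), numReduced_eq (by omega)]
    exact card_disjointPairs_le_succ (by omega)

theorem numReduced_pos {n : ℕ} (hn : 1 ≤ n) : 1 ≤ numReduced n :=
  numReduced_one ▸ numReduced_monotone hn

theorem exists_numReduced_succ_le :
    ∃ C : ℕ, ∀ n, 1 ≤ n → numReduced (n + 1) ≤ C * numReduced n := by
  obtain ⟨N, hN⟩ := eventually_atTop.1 eventually_card_disjointPairs_succ_le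
  refine ⟨37 + ∑ n ∈ Finset.range (N + 2), numReduced (n + 1), fun n hn => ?_⟩
  rcases Nat.lt_or_ge n (N + 2) with h | h
  · have h1 : numReduced (n + 1) ≤ ∑ n ∈ Finset.range (N + 2), numReduced (n + 1) :=
      Finset.single_le_sum (f := fun n => numReduced (n + 1)) (fun _ _ => Nat.zero_le _)
        (Finset.mem_range.2 h)
    exact le_trans (h1.trans (Nat.le_add_left _ _)) (Nat.le_mul_of_pos_right _ (numReduced_pos hn))
  · rw [numReduced_eq (by omega), numReduced_eq (by omega)]
    exact (hN n (by omega)).trans (Nat.mul_le_mul_right _ (Nat.le_add_right _ _))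

theorem sum_antidiagonal_ite_mul_le (a : ℕ) (u : ℕ → ℕ) (hu : Monotone u) (n : ℕ) :
    ∑ p ∈ Finset.HasAntidiagonal.antidiagonal n, (if p.2 = a then 1 else 0) * u p.1 ≤ u n := by
  rw [← Finset.Nat.sum_antidiagonal_swap, Finset.Nat.sum_antidiagonal_eq_sum_range_succ_mk]
  simp only [Prod.fst_swap, Prod.snd_swap, ite_mul, one_mul, zero_mul]
  rw [Finset.sum_ite_eq']
  split_ifs
  · exact hu (Nat.sub_le _ _)
  · exact Nat.zero_le _

theorem exists_sum_numReduced_mul_le :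
    ∃ C : ℕ, ∀ n, ∑ p ∈ Finset.HasAntidiagonal.antidiagonal n, numReduced p.1 * numReduced p.2 ≤
      C * numReduced n := by
  obtain ⟨C, hC⟩ := exists_numReduced_succ_le
  refine ⟨C + 2, fun n => ?_⟩
  rcases Nat.eq_zero_or_pos n with rfl | hn
  · simp [numReduced_zero]
  -- The two correction terms account for the pair of single carets, missing from `disjointPairs 1`;
  -- each sums to at most `numReduced n`.
  have hterm : ∀ i j, numReduced i * numReduced j ≤
      (disjointPairs i).card * (disjointPairs j).card +
        (if i = 1 then 1 else 0) * numReduced j + (if j = 1 then 1 else 0) * numReduced i := by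
    intro i j
    by_cases hi : i = 1
    · rw [hi, numReduced_one]; simp; omega
    by_cases hj : j = 1
    · rw [hj, numReduced_one]; simp
    simp only [hi, hj, if_false, zero_mul, add_zero]
    have : ∀ i, i ≠ 1 → numReduced i ≤ (disjointPairs i).card := fun i hi => by
      rcases Nat.eq_zero_or_pos i with rfl | hi0
      · rw [numReduced_zero]; exact Nat.zero_le _
      · exact (numReduced_eq (by omega)).le
    exact Nat.mul_le_mul (this i hi) (this j hj)
  refine (Finset.sum_le_sum fun p _ => hterm p.1 p.2).trans ?_
  rw [Finset.sum_add_distrib, Finset.sum_add_distrib]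
  have h1 := sum_card_disjointPairs_mul_le hn
  have h2 := sum_antidiagonal_ite_mul_le 1 _ numReduced_monotone n
  have h3 : ∑ p ∈ Finset.HasAntidiagonal.antidiagonal n,
      (if p.1 = 1 then 1 else 0) * numReduced p.2 ≤ numReduced n := by
    rw [← Finset.Nat.sum_antidiagonal_swap]
    exact h2
  have h4 := hC n hn
  rw [numReduced_eq (n := n + 1) (by omega)] at h4
  rw [add_mul]
  omega

/-! ### The size of the spheres -/

theorem ncard_sphSum_succ_le (k n : ℕ) :
    (sphSum (k + 1) n).ncard ≤
      ∑ p ∈ Finset.HasAntidiagonal.antidiagonal n, numReduced p.1 * (sphSum k p.2).ncard := by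
  have hsub : sphSum (k + 1) n ⊆ ⋃ p ∈ Finset.HasAntidiagonal.antidiagonal n,
      (fun x : ReducedTreePair × Sym ReducedTreePair k => x.1 ::ₛ x.2) ''
        (reducedOfSize p.1 ×ˢ sphSum k p.2) := by
    intro M hM
    obtain ⟨t, M', rfl⟩ := M.exists_eq_cons_of_succ
    simp only [sphSum, mem_ofPred_eq, Sym.coe_cons, Multiset.map_cons, Multiset.sum_cons] at hM
    simp only [mem_iUnion]
    exact ⟨(_, _), Finset.HasAntidiagonal.mem_antidiagonal.2 hM, (t, M'), ⟨rfl, rfl⟩, rfl⟩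
  have hfin : ∀ p : ℕ × ℕ, ((fun x : ReducedTreePair × Sym ReducedTreePair k => x.1 ::ₛ x.2) ''
        (reducedOfSize p.1 ×ˢ sphSum k p.2)).Finite := fun p =>
    ((reducedOfSize_finite _).prod (sphSum_finite _ _)).image _
  refine (ncard_le_ncard hsub (Set.Finite.biUnion (Finset.finite_toSet _) fun p _ => hfin p)).trans
    ((Finset.set_ncard_biUnion_le _ _).trans (Finset.sum_le_sum fun p _ => ?_))
  refine (ncard_image_le ((reducedOfSize_finite _).prod (sphSum_finite _ _))).trans ?_
  rw [ncard_prod, numReduced]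

/-- Each further entry is a convolution with `numReduced`, which costs a constant factor. The extra
term at n = 0 is the empty tuple, where the induction starts. -/
theorem exists_ncard_sphSum_le (k : ℕ) :
    ∃ C : ℕ, ∀ n, (sphSum k n).ncard ≤ C * numReduced n + if n = 0 then 1 else 0 := by
  induction k with
  | zero =>
    refine ⟨0, fun n => ?_⟩
    split_ifs with h
    · have := ncard_le_ncard (subset_univ (sphSum 0 n))
      simpa using this
    · rw [ncard_eq_zero (sphSum_finite _ _) |>.2]
      · exact Nat.zero_le _
      · ext M
        simp only [sphSum, mem_ofPred_eq, mem_empty_iff_false, iff_false]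
        rw [Subsingleton.elim M Sym.nil]
        simpa using Ne.symm h
  | succ k ih =>
    obtain ⟨C, hC⟩ := ih
    obtain ⟨K, hK⟩ := exists_sum_numReduced_mul_le
    refine ⟨C * K + 1, fun n => (ncard_sphSum_succ_le k n).trans (le_trans ?_ le_self_add)⟩
    have h1 : ∑ p ∈ Finset.HasAntidiagonal.antidiagonal n, numReduced p.1 * (sphSum k p.2).ncard ≤
        ∑ p ∈ Finset.HasAntidiagonal.antidiagonal n, (C * (numReduced p.1 * numReduced p.2) +
          (if p.2 = 0 then 1 else 0) * numReduced p.1) :=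
      Finset.sum_le_sum fun p _ => (Nat.mul_le_mul_left _ (hC p.2)).trans_eq (by ring)
    refine h1.trans ?_
    rw [Finset.sum_add_distrib, ← Finset.mul_sum, add_mul, one_mul, mul_assoc]
    exact add_le_add (Nat.mul_le_mul_left _ (hK n))
      (sum_antidiagonal_ite_mul_le 0 _ numReduced_monotone n)

theorem exists_numReduced_add_le (c : ℕ) :
    ∃ C : ℕ, ∀ n, 1 ≤ n → numReduced (n + c) ≤ C * numReduced n := by
  obtain ⟨C, hC⟩ := exists_numReduced_succ_le
  refine ⟨C ^ c, fun n hn => ?_⟩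
  induction c with
  | zero => simp
  | succ c ih =>
    calc numReduced (n + c + 1) ≤ C * numReduced (n + c) := hC _ (by omega)
      _ ≤ C * (C ^ c * numReduced n) := Nat.mul_le_mul_left _ ih
      _ = _ := by ring

/-! ### Visibility -/

/-- A set of tuples has positive lower density if it contains all tuples obtained by
completing one reduced tree pair to a tuple in an injective way that increases the sum of the
sizes by a constant. -/
theorem lowerSumDensity_pos {k c : ℕ} {T : Set (Sym ReducedTreePair k)}
    (F : ReducedTreePair → Sym ReducedTreePair k)
    (hF : InjOn F {t | 2 ≤ t.size})
    (hT : ∀ t : ReducedTreePair, 2 ≤ t.size → F t ∈ T)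
    (hc : ∀ t : ReducedTreePair, 2 ≤ t.size → F t ∈ sphSum k (t.size + c)) :
    0 < lowerSumDensity T := by
  obtain ⟨C, hC⟩ := exists_ncard_sphSum_le k
  obtain ⟨K, hK⟩ := exists_numReduced_add_le c
  have hpos : (0 : ℝ) < 1 / (C * K + 1) := by positivity
  refine hpos.trans_le (le_liminf_of_le ?_ ?_)
  -- A lower bound for a real `liminf` needs the ratios bounded above; they are at most 1.
  · refine IsCoboundedUnder.of_frequently_le (a := 1) (Frequently.of_forall fun n => ?_)
    refine div_le_one_of_le₀ ?_ (Nat.cast_nonneg _)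
    exact_mod_cast ncard_le_ncard inter_subset_right (sphSum_finite k n)
  · filter_upwards [eventually_ge_atTop (c + 2)] with n hn
    obtain ⟨m, rfl⟩ : ∃ m, n = m + c := ⟨n - c, by omega⟩
    have hm : 2 ≤ m := by omega
    have h1 : numReduced m ≤ (T ∩ sphSum k (m + c)).ncard := by
      rw [numReduced, ← InjOn.ncard_image (hF.mono fun t ht => ?_)]
      · refine ncard_le_ncard ?_ ((sphSum_finite k _).inter_of_right _)
        rintro _ ⟨t, ht, rfl⟩
        have ht' : t.size = m := ht
        exact ⟨hT t (by omega), ht' ▸ hc t (by omega)⟩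
      · have ht' : t.size = m := ht
        exact hm.trans_eq ht'.symm
    have h2 : (sphSum k (m + c)).ncard ≤ C * (K * numReduced m) := by
      have := hC (m + c)
      rw [if_neg (by omega), add_zero] at this
      exact this.trans (Nat.mul_le_mul_left _ (hK m (by omega)))
    have h3 : 1 ≤ numReduced m := numReduced_pos (by omega)
    have h4 : 0 < (sphSum k (m + c)).ncard :=
      lt_of_lt_of_le (show 0 < (T ∩ sphSum k (m + c)).ncard by omega)
        (ncard_le_ncard inter_subset_right (sphSum_finite k _))
    rw [sphSumRatio, div_le_div_iff₀ (by positivity) (by exact_mod_cast h4), one_mul]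
    have : (sphSum k (m + c)).ncard ≤ (T ∩ sphSum k (m + c)).ncard * (C * K + 1) := by
      calc _ ≤ C * (K * numReduced m) := h2
        _ ≤ numReduced m * (C * K + 1) := by nlinarith
        _ ≤ _ := Nat.mul_le_mul_right _ h1
    exact_mod_cast this

theorem mem_specSum_of_generators {k : ℕ} (H : Subgroup ThompsonF) (g : Fin k → H)
    (hg : Subgroup.closure (range g) = ⊤) (χ : H →* Multiplicative ℤ) (i : Fin k)
    (hi : χ (g i) ≠ 1) (hj : ∀ j ≠ i, χ (g j) = 1) : H ∈ specSum k := by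
  obtain ⟨ψ, hψi, hψj⟩ := exists_hom_eq_one_of_ne_one χ g hg i hi hj
  obtain ⟨a, ha⟩ := ReducedTreePair.toF_surjective (g i)
  have ha2 : 2 ≤ a.size := a.two_le_size_of_toF_ne_one fun h => hi (by
    rw [show g i = 1 from Subtype.ext (ha.symm.trans h), map_one])
  -- These entries stay fixed, so any reduced representatives do; their sizes enter only the
  -- constant c.
  choose b hb using fun j => ReducedTreePair.toF_surjective (joinF (g j) 1)
  let B : Multiset ReducedTreePair := (Finset.univ.erase i).val.map b
  have hB : Multiset.card B + 1 = k := by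
    have : 0 < k := i.pos
    simp [B]; omega
  -- The value for sizes below 2, where the join need not be reduced, is never used.
  let J : ReducedTreePair → ReducedTreePair := fun t =>
    if h : 2 ≤ t.size then ⟨a.1.join t.1, a.2.join t.2 ha2 h⟩ else t
  have hJ : ∀ t : ReducedTreePair, 2 ≤ t.size → (J t).1 = a.1.join t.1 := fun t ht => by
    have : J t = ⟨a.1.join t.1, a.2.join t.2 ha2 ht⟩ := dif_pos ht
    rw [this]
  let F : ReducedTreePair → Sym ReducedTreePair k := fun t => ⟨J t ::ₘ B, by simp [hB]⟩
  refine lowerSumDensity_pos (c := a.size + 1 + (B.map ReducedTreePair.size).sum) F ?_ ?_ ?_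
  · intro t ht t' ht' he
    -- All the tuples share the multiset B, so cancelling it recovers J t although the tuples are
    -- unordered.
    have h1 : J t ::ₘ B = J t' ::ₘ B := congrArg Subtype.val he
    have h2 := congrArg Subtype.val ((Multiset.cons_inj_left B).1 h1)
    rw [hJ t ht, hJ t' ht'] at h2
    exact Subtype.ext (a.1.join_right_injective h2)
  · intro t ht
    have h := nonempty_closure_range_joinF_mulEquiv g hg ψ i hψi hψj t.toF
    have hJF : (J t).toF = joinF (g i) t.toF := by
      change (J t).1.toF = _
      rw [hJ t ht, TreePair.toF_join, ← ha]; rfl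
    have hset : {x | ∃ s ∈ F t, s.toF = x} =
        range fun j => joinF (g j) (if j = i then t.toF else 1) := by
      ext x
      constructor
      · rintro ⟨s, hs, rfl⟩
        rcases Multiset.mem_cons.1 (show s ∈ J t ::ₘ B from hs) with rfl | hs
        · exact ⟨i, by simp [hJF]⟩
        · obtain ⟨j, hj, rfl⟩ := Multiset.mem_map.1 hs
          have hji : j ≠ i := (Finset.mem_erase.1 (Finset.mem_def.2 hj)).1
          exact ⟨j, by simp [hji, hb]⟩
      · rintro ⟨j, rfl⟩
        by_cases hji : j = i
        · subst hji
          exact ⟨J t, show J t ∈ J t ::ₘ B from Multiset.mem_cons_self _ _, by simp [hJF]⟩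
        · refine ⟨b j, show b j ∈ J t ::ₘ B from
            Multiset.mem_cons_of_mem (Multiset.mem_map_of_mem _ ?_), by simp [hji, hb]⟩
          exact Finset.mem_erase.2 ⟨hji, Finset.mem_univ _⟩
    change Nonempty (Subgroup.closure {x | ∃ s ∈ F t, s.toF = x} ≃* H)
    rw [hset]
    exact h
  · intro t ht
    change ((J t ::ₘ B).map ReducedTreePair.size).sum = _
    rw [Multiset.map_cons, Multiset.sum_cons, ReducedTreePair.size, hJ t ht, TreePair.size_join]
    simp only [ReducedTreePair.size]
    omega

theorem mainTheorem2 (m : ℕ) (h : Fin m → ThompsonF) (H : Subgroup ThompsonF)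
    (hgen : H = Subgroup.closure (Set.range h)) (hne : H ≠ ⊥) (k : ℕ) (hk : m ≤ k) :
    H ∈ specSum k := by
  obtain ⟨χ, hχ⟩ := exists_hom_int_ne_one h H hgen hne
  have hmem : ∀ i, h i ∈ H := fun i => hgen ▸ Subgroup.subset_closure ⟨i, rfl⟩
  -- The m generators are padded with 1 to a family of length k.
  let g : Fin k → H := fun j => if hj : j.1 < m then ⟨h ⟨j.1, hj⟩, hmem _⟩ else 1
  have hg : Subgroup.closure (range g) = ⊤ := by
    apply Subgroup.map_injective H.subtype_injective
    rw [← MonoidHom.range_eq_map, Subgroup.range_subtype, MonoidHom.map_closure]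
    apply le_antisymm
    · rw [Subgroup.closure_le]
      rintro _ ⟨x, -, rfl⟩
      exact x.2
    · conv_lhs => rw [hgen]
      refine Subgroup.closure_mono ?_
      rintro _ ⟨i, rfl⟩
      exact ⟨g (Fin.castLE hk i), ⟨_, rfl⟩, by simp [g]⟩
  obtain ⟨g', i, hg', hi, hj⟩ := exists_generators_hom_trivial_off χ hχ g hg
  exact mem_specSum_of_generators H g' hg' χ i hi hj
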